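/- Let $N,k,d$ be non-negative integers with $k\le N$, put $n=N+k$, and let $V_\sigma$ ($\sigma\in S(n)$) be the operators permuting the tensor factors of $(\mathbb C^d)^{\otimes n}$. Let $\mathcal A$ be the algebra generated by the operators $V_\sigma^{t_{N+1}\cdots t_n}$, $\sigma\in S(n)$, where $t_s$ is the partial transposition on the $s$-th factor. Let $$V^{(k)}=V^{t_n}_{N-k+1,n}\,V^{t_{n-1}}_{N-k+2,n-1}\cdots V^{t_{N+1}}_{N,N+1},$$ where $V_{r,s}$ is the swap of the factors $r$ and $s$, and let $\mathcal M$ be the two-sided ideal of $\mathcal A$ generated by $V^{(k)}$. For each Young diagram $\mu$ with $m\le N$ boxes let $\phi^\mu$ be a unitary matrix irrep of $S(m)$ labelled by $\mu$ (isomorphic to the Specht module of $\mu$), with rows and columns indexed by the paths in Young's lattice from the empty diagram to $\mu$, and assume that these irreps are in partially reduced (PRIR) form: restricted to $S(m-1)$, $\phi^\mu$ is the block diagonal sum of the $\phi^\kappa$ over the diagrams $\kappa$ obtained from $\mu$ by removing one box, an index of $\phi^\kappa$ being identified with the path that it extends to. For $\mu\vdash N$ and indices $i,j$ of $\phi^\mu$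 put $$E^\mu_{ij}=\frac{d_\mu}{N!}\sum_{\tau\in S(N)}\phi^\mu_{ji}(\tau^{-1})V_\tau ,$$ acting on the first $N$ factors, where $d_\mu=\dim\phi^\mu$. Let $m_\mu$ (resp. $m_\alpha$) be the multiplicity of $\phi^\mu$ in $(\mathbb C^d)^{\otimes N}$ for $\mu\vdash N$ (resp. of $\phi^\alpha$ in $(\mathbb C^d)^{\otimes (N-k)}$ for $\alpha\vdash N-k$). Fix for each $\alpha$ an index $1_\alpha$ of $\phi^\alpha$. For a path $r$ in Young's lattice from $\alpha\vdash N-k$ to $\mu\vdash N$, let $(r,1_\alpha)$ be the index of $\phi^\mu$ obtained by continuing the path $1_\alpha$ along $r$. For paths $r$ from $\alpha$ to $\mu$ and $s$ from $\alpha$ to $\nu$, put $$F^{r\,s}_{i\,j}=\frac{m_\alpha}{\sqrt{m_\mu m_\nu}}\;E^\mu_{i,(r,1_\alpha)}\,V^{(k)}\,E^\nu_{(s,1_\alpha),j},\qquad F_\mu(\alpha)=\sum_{r}\sum_{i}F^{r\,r}_{i\,i},$$ where $r$ runs over all paths from $\alpha$ to $\mu$ and $i$ over all indices of $\phi^\mu$.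 Consider the pairs $(\alpha,\mu)$ of Young diagrams with at most $d$ rows such that $\alpha\vdash N-k$, $\mu\vdash N$ and $\alpha\subseteq\mu$. Then each $F_\mu(\alpha)$ is a (Hermitian) projector, $F_\mu(\alpha)F_\nu(\beta)=0$ whenever $(\alpha,\mu)\ne(\beta,\nu)$, and $$\sum_{\alpha}\sum_{\mu\supseteq\alpha}F_\mu(\alpha)=\mathbf 1_{\mathcal M},$$ that is, this sum lies in $\mathcal M$ and is a two-sided identity for all elements of $\mathcal M$. -/

import Mathlib

open Equiv

/-! ### Paths in Young's lattice -/

/-- Paths from `α` up to `μ` in Young's lattice: chains of Young diagrams in which every diagram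
covers the previous one, i.e. arises from it by adding one box. -/
inductive YoungPath (α : YoungDiagram) : YoungDiagram → Type
  | nil : YoungPath α α
  | cons {κ μ : YoungDiagram} (p : YoungPath α κ) (h : κ ⋖ μ) : YoungPath α μ

namespace YoungPath

/-- Concatenation of a path from `α` to `β` with a path from `β` to `γ`. -/
def comp {α β : YoungDiagram} (p : YoungPath α β) :
    {γ : YoungDiagram} → YoungPath β γ → YoungPath α γ
  | _, nil => p
  | _, cons q h => cons (p.comp q) h

/-- Removal of the last step of a path. -/
def unsnoc {α : YoungDiagram} : {μ : YoungDiagram} → YoungPath α μ →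
    Option (Σ κ : {κ : YoungDiagram // κ ⋖ μ}, YoungPath α κ.1)
  | _, nil => none
  | _, cons p h => some ⟨⟨_, h⟩, p⟩

theorem unsnoc_injective {α μ : YoungDiagram} :
    Function.Injective (unsnoc : YoungPath α μ → _) := by
  intro p q hpq
  cases p with
  | nil =>
    cases q with
    | nil => rfl
    | cons q h => simp [unsnoc] at hpq
  | cons p h =>
    cases q with
    | nil => simp [unsnoc] at hpq
    | cons q h' =>
      simp only [unsnoc, Option.some.injEq, Sigma.mk.injEq, Subtype.mk.injEq] at hpq
      obtain ⟨h1, h2⟩ := hpq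
      subst h1
      simp at h2
      subst h2
      rfl

end YoungPath

theorem YoungDiagram.finite_Iic (μ : YoungDiagram) : (Set.Iic μ).Finite := by
  apply Set.Finite.of_finite_image (f := YoungDiagram.cells)
  · apply (Finset.finite_toSet μ.cells.powerset).subset
    rintro _ ⟨κ, hκ, rfl⟩
    simpa using YoungDiagram.cells_subset_iff.2 hκ
  · intro a _ b _ h
    exact YoungDiagram.ext h

theorem YoungPath.finite (α : YoungDiagram) :
    ∀ (n : ℕ) (μ : YoungDiagram), μ.card ≤ n → Finite (YoungPath α μ)
  | n, μ, hn => by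
    have hlt : ∀ κ : YoungDiagram, κ ⋖ μ → κ.card < μ.card := fun κ h =>
      Finset.card_lt_card (YoungDiagram.cells_ssubset_iff.2 h.lt)
    have h1 : Finite {κ : YoungDiagram // κ ⋖ μ} :=
      (μ.finite_Iic.subset (fun κ (h : κ ⋖ μ) => h.le)).to_subtype
    have h2 : ∀ κ : {κ : YoungDiagram // κ ⋖ μ}, Finite (YoungPath α κ.1) := fun κ =>
      match n, hn with
      | 0, hn => absurd (hlt κ.1 κ.2) (by omega)
      | n + 1, hn => YoungPath.finite α n κ.1 (by have := hlt κ.1 κ.2; omega)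
    exact Finite.of_injective _ (YoungPath.unsnoc_injective (α := α) (μ := μ))

noncomputable instance (α μ : YoungDiagram) : Fintype (YoungPath α μ) :=
  haveI := YoungPath.finite α μ.card μ le_rfl
  Fintype.ofFinite _

noncomputable instance (α μ : YoungDiagram) : DecidableEq (YoungPath α μ) := Classical.decEq _

/-- The basis indices of the irrep labelled by `μ`: paths from the empty diagram to `μ`
(equivalently, standard Young tableaux of shape `μ`). -/
abbrev YoungIndex (μ : YoungDiagram) : Type := YoungPath ⊥ μ

theorem finite_youngDiagrams (m d : ℕ) :
    {μ : YoungDiagram | μ.card = m ∧ μ.colLen 0 ≤ d}.Finite := by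
  apply Set.Finite.of_finite_image (f := YoungDiagram.cells)
  · apply (Finset.finite_toSet (Finset.range m ×ˢ Finset.range m).powerset).subset
    rintro _ ⟨μ, ⟨hμ, -⟩, rfl⟩
    simp only [Finset.coe_powerset, Set.mem_preimage, Set.mem_powerset_iff, Finset.coe_subset]
    rintro ⟨i, j⟩ hij
    have hsub : Finset.range (i + 1) ×ˢ Finset.range (j + 1) ⊆ μ.cells := by
      rintro ⟨a, b⟩ hab
      simp only [Finset.mem_product, Finset.mem_range] at hab
      exact μ.up_left_mem (by omega) (by omega) hij
    have hcard := Finset.card_le_card hsub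
    simp only [Finset.card_product, Finset.card_range] at hcard
    change _ ≤ μ.card at hcard
    simp only [Finset.mem_product, Finset.mem_range]
    constructor <;> nlinarith
  · intro a _ b _ h
    exact YoungDiagram.ext h

/-- The Young diagrams with `m` boxes and at most `d` rows. -/
noncomputable def youngDiagrams (m d : ℕ) : Finset YoungDiagram :=
  (finite_youngDiagrams m d).toFinset

open Classical in
/-- The Young diagrams with `m` boxes and at most `d` rows that contain `α`. -/
noncomputable def youngDiagramsAbove (α : YoungDiagram) (m d : ℕ) : Finset YoungDiagram :=
  (youngDiagrams m d).filter fun μ => α ≤ μ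

/-! ### Irreps of the symmetric groups and partially reduced (PRIR) bases -/

open Classical in
/-- The Young symmetrizer of the filling `t` of the boxes of `μ` with `0, …, m - 1`: the sum of
all permutations preserving the rows, times the signed sum of all those preserving the columns. -/
noncomputable def youngSymmetrizer {m : ℕ} {μ : YoungDiagram} (t : Fin m ≃ μ.cells) :
    MonoidAlgebra ℂ (Perm (Fin m)) :=
  (∑ p : Perm (Fin m) with ∀ i, (t (p i)).1.1 = (t i).1.1, MonoidAlgebra.single p 1) *
    ∑ q : Perm (Fin m) with ∀ i, (t (q i)).1.2 = (t i).1.2,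
      MonoidAlgebra.single q ((Perm.sign q : ℤ) : ℂ)

/-- The linear representation defined by a unitary matrix representation. -/
noncomputable def matrixRep {G ι : Type} [Group G] [Fintype ι] [DecidableEq ι]
    (ρ : G →* Matrix.unitaryGroup ι ℂ) : Representation ℂ G (ι → ℂ) :=
  (Matrix.toLinAlgEquiv' : Matrix ι ι ℂ ≃ₐ[ℂ] _).toAlgHom.toMonoidHom.comp
    ((Matrix.unitaryGroup ι ℂ).subtype.comp ρ)

/-- `ρ` is (isomorphic to) the irrep of the symmetric group labelled by `μ`: it is irreducible and
isomorphic to the Specht module, the left ideal of the group algebra generated by a Young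
symmetrizer of shape `μ`. -/
def IsIrrepOfShape {m : ℕ} {ι : Type} [Fintype ι] [DecidableEq ι] (μ : YoungDiagram)
    (ρ : Perm (Fin m) →* Matrix.unitaryGroup ι ℂ) : Prop :=
  (matrixRep ρ).IsIrreducible ∧
  ∃ (t : Fin m ≃ μ.cells) (f : (ι → ℂ) →ₗ[ℂ] MonoidAlgebra ℂ (Perm (Fin m))),
    Function.Injective f ∧
    LinearMap.range f = (Ideal.span {youngSymmetrizer t}).restrictScalars ℂ ∧
    ∀ (σ : Perm (Fin m)) (v : ι → ℂ),
      f (matrixRep ρ σ v) = MonoidAlgebra.single σ 1 * f v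

/-- A family of candidate matrix representations `φ m μ` of `S(m)`, with rows and columns indexed
by paths. Only the members with `μ` a diagram with `m` boxes are ever used. -/
abbrev MatrixFamily : Type :=
  (m : ℕ) → (μ : YoungDiagram) → Perm (Fin m) →* Matrix.unitaryGroup (YoungIndex μ) ℂ

/-- The family `φ` consists, for all Young diagrams `μ` with `m ≤ N` boxes, of unitary irreps of
`S(m)` labelled by `μ` in partially reduced (PRIR) form: restricted to `S(m)`, the irrep of
`S(m + 1)` labelled by `μ` is the block diagonal sum of the irreps labelled by the diagrams `κ`
covered by `μ`, the index `p.cons h` being the index `p` of the block of `κ`. -/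
structure IsPRIR (N : ℕ) (φ : MatrixFamily) : Prop where
  irrep : ∀ (m : ℕ) (μ : YoungDiagram), m ≤ N → μ.card = m → IsIrrepOfShape μ (φ m μ)
  restrict_same : ∀ (m : ℕ) (μ κ : YoungDiagram) (h : κ ⋖ μ), m + 1 ≤ N → μ.card = m + 1 →
    ∀ (σ : Perm (Fin m)) (p q : YoungIndex κ),
      (φ (m + 1) μ (σ.viaEmbedding Fin.castSuccEmb)).1 (p.cons h) (q.cons h) = (φ m κ σ).1 p q
  restrict_ne : ∀ (m : ℕ) (μ κ κ' : YoungDiagram) (h : κ ⋖ μ) (h' : κ' ⋖ μ), κ ≠ κ' →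
    m + 1 ≤ N → μ.card = m + 1 →
    ∀ (σ : Perm (Fin m)) (p : YoungIndex κ) (q : YoungIndex κ'),
      (φ (m + 1) μ (σ.viaEmbedding Fin.castSuccEmb)).1 (p.cons h) (q.cons h') = 0

/-! ### Operators on `(ℂ^d)^{⊗ n}`

They are written as matrices in the product basis `e_x = e_{x 0} ⊗ ⋯ ⊗ e_{x (n-1)}`. -/

/-- Operators on the `n`-fold tensor power of `ℂ^d`. -/
abbrev TensorOp (n d : ℕ) : Type := Matrix (Fin n → Fin d) (Fin n → Fin d) ℂ

/-- The operator `V_σ` permuting the tensor factors: it moves the factor at position `i` to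
position `σ i`. -/
def permOp (n d : ℕ) (σ : Perm (Fin n)) : TensorOp n d :=
  Matrix.of fun y x => if y = fun i => x (σ⁻¹ i) then 1 else 0

/-- Partial transposition with respect to the tensor factor `s`. -/
def partialTranspose {n d : ℕ} (s : Fin n) (A : TensorOp n d) : TensorOp n d :=
  Matrix.of fun x y => A (Function.update x s (y s)) (Function.update y s (x s))

/-- Partial transposition with respect to the last `k` of `N + k` tensor factors. -/
def partialTransposeLast (N k : ℕ) {d : ℕ} (A : TensorOp (N + k) d) : TensorOp (N + k) d :=
  (List.finRange k).foldr (fun j B => partialTranspose (Fin.natAdd N j) B) A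

/-- The algebra of partially transposed permutation operators: the algebra generated by the
permutation operators of `N + k` systems, partially transposed on the last `k` systems. -/
def partiallyTransposedAlgebra (N k d : ℕ) : Subalgebra ℂ (TensorOp (N + k) d) :=
  Algebra.adjoin ℂ (Set.range fun σ : Perm (Fin (N + k)) =>
    partialTransposeLast N k (permOp (N + k) d σ))

/-- The operator `V^{(k)}`, the product over `j = 0, …, k - 1` of the partial transposes (on the
second named system) of the swaps of system `N - k + j` with system `N + k - 1 - j`; systems are
numbered from `0`. -/
def contractionOp (N k d : ℕ) : TensorOp (N + k) d :=
  (List.ofFn fun j : Fin k =>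
    partialTranspose ⟨N + k - 1 - j, by omega⟩
      (permOp (N + k) d (Equiv.swap ⟨N - k + j, by omega⟩ ⟨N + k - 1 - j, by omega⟩))).prod

/-- The two-sided ideal `M` of the algebra of partially transposed permutation operators that is
generated by `V^{(k)}`. -/
def maximalIdeal (N k d : ℕ) : Submodule ℂ (TensorOp (N + k) d) :=
  Submodule.span ℂ {x | ∃ a ∈ partiallyTransposedAlgebra N k d,
    ∃ b ∈ partiallyTransposedAlgebra N k d, x = a * contractionOp N k d * b}

/-! ### The operators `E`, `F` and `F_μ(α)` -/

/-- Matrices of the linear maps from the representation space of `φ m μ` to `(ℂ^d)^{⊗ m}` which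
commute with the action of `S(m)`. -/
def intertwiners (φ : MatrixFamily) (m d : ℕ) (μ : YoungDiagram) :
    Submodule ℂ (Matrix (Fin m → Fin d) (YoungIndex μ) ℂ) where
  carrier := {T | ∀ σ : Perm (Fin m), permOp m d σ * T = T * (φ m μ σ).1}
  add_mem' := by
    intro S T hS hT σ
    rw [Matrix.mul_add, Matrix.add_mul, hS σ, hT σ]
  zero_mem' := by
    intro σ
    simp
  smul_mem' := by
    intro c T hT σ
    rw [Matrix.mul_smul, Matrix.smul_mul, hT σ]

/-- The multiplicity `m_μ` of the irrep of `S(m)` labelled by `μ` in `(ℂ^d)^{⊗ m}`. -/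
noncomputable def irrepMultiplicity (φ : MatrixFamily) (m d : ℕ) (μ : YoungDiagram) : ℕ :=
  Module.finrank ℂ (intertwiners φ m d μ)

/-- The operator `E_{ij}^μ = (d_μ / N!) ∑_τ φ^μ_{ji}(τ⁻¹) V_τ`, with `τ` in `S(N)`, acting on the
first `N` of `N + k` systems. -/
noncomputable def opE (φ : MatrixFamily) (N k d : ℕ) (μ : YoungDiagram) (i j : YoungIndex μ) :
    TensorOp (N + k) d :=
  ((Fintype.card (YoungIndex μ) : ℂ) / (N.factorial : ℂ)) •
    ∑ τ : Perm (Fin N), (φ N μ τ⁻¹).1 j i •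
      permOp (N + k) d (τ.viaEmbedding (Fin.castAddEmb k))

/-- The operator `F_{i j}^{r s}`, for paths `r` from `α` to `μ` and `s` from `α` to `ν` and indices
`i` of `μ` and `j` of `ν`. The choice function `one` fixes an index `1_α` of every `α`. -/
noncomputable def opF (φ : MatrixFamily) (one : (α : YoungDiagram) → YoungIndex α) (N k d : ℕ)
    {α μ ν : YoungDiagram} (r : YoungPath α μ) (s : YoungPath α ν)
    (i : YoungIndex μ) (j : YoungIndex ν) : TensorOp (N + k) d :=
  (((irrepMultiplicity φ (N - k) d α : ℝ) /
      Real.sqrt ((irrepMultiplicity φ N d μ : ℝ) * (irrepMultiplicity φ N d ν : ℝ)) : ℝ) : ℂ) •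
    (opE φ N k d μ i ((one α).comp r) * contractionOp N k d * opE φ N k d ν ((one α).comp s) j)

/-- The operator `F_μ(α) = ∑_r ∑_i F_{i i}^{r r}`, summed over all paths `r` from `α` to `μ` and all
indices `i` of `μ`. -/
noncomputable def projF (φ : MatrixFamily) (one : (α : YoungDiagram) → YoungIndex α) (N k d : ℕ)
    (α μ : YoungDiagram) : TensorOp (N + k) d :=
  ∑ r : YoungPath α μ, ∑ i : YoungIndex μ, opF φ one N k d r r i i

/-- The sum of the operators `F_μ(α)` over all `α` with `N - k` boxes and all `μ` with `N` boxes
that contain `α`; only diagrams with at most `d` rows are considered. -/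
noncomputable def sumProjF (φ : MatrixFamily) (one : (α : YoungDiagram) → YoungIndex α)
    (N k d : ℕ) : TensorOp (N + k) d :=
  ∑ α ∈ youngDiagrams (N - k) d, ∑ μ ∈ youngDiagramsAbove α N d, projF φ one N k d α μ

/-! Write N = M + k and let W (`pairInsertion`) be the map that tensors a vector on M systems with k
unnormalized maximally entangled pairs. Three identities govern it: V^(k) = W W*
(`contractionOp_eq`), W* (X ⊗ 1) W = Tr_k X for X on the first N systems
(`pairInsertion_conjTranspose_mul_extendOp_mul`), and (Y ⊗ 1) W = W Y for Y on the first M systems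
(`extendOp_extendOp_mul_pairInsertion`).

With A_{r,i} = (E^μ_{i,(r,1_α)} ⊗ 1) W (`projFactor`), the operator F^{rr}_{ii} is (m_α / m_μ)
A_{r,i} A_{r,i}*. Everything about products of the F_μ(α) is therefore contained in the Gram
operators A* A, which vanish or are partial traces Tr_k E^μ_{(r,1_α),(s,1_β)}. Such a partial trace
lies in the image of ℂ[S(M)], and the PRIR form lets E^μ absorb units E^α and E^β on either side. By
Schur orthogonality it vanishes for α ≠ β and is a multiple of E^α_{11} for α = β; taking traces
shows that the multiple vanishes for r ≠ s and is m_μ / m_α for r = s. After normalization the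
A_{r,i} are thus partial isometries with orthogonal ranges, which gives the projector and
orthogonality statements.

For the identity of the ideal, partial transposition against maximally entangled pairs turns every
generator of the algebra into an operator on the first N systems, so the algebra maps W into
(ℂ[S(N)] ⊗ 1) W (`exists_mul_extendOp_mul_pairInsertion`). The matrix units E^μ_{ij} span ℂ[S(N)]:
they are linearly independent because Specht modules of different shapes are inequivalent, and their
number is ∑ d_μ² = N!. Units of diagrams with more than d rows act as zero. For the others, j is a
path (a, r) through some α with M boxes, and (E^μ_{i,(r,a)} ⊗ 1) W = A_{r,i} E^α_{1a}, which the sum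
of the F_μ(α) fixes. Adjoints give the right identity. -/

theorem MonoidAlgebra.single_finset_sum {G R ι : Type*} [Semiring R] (g : G) (s : Finset ι)
    (f : ι → R) :
    MonoidAlgebra.single g (∑ i ∈ s, f i) = ∑ i ∈ s, MonoidAlgebra.single g (f i) :=
  map_sum (MonoidAlgebra.singleAddHom g) f s

/-! ### Schur orthogonality and matrix units in the group algebra. -/

section SchurOrthogonality

variable {G ι κ : Type} [Group G] [Fintype ι] [DecidableEq ι] [Fintype κ] [DecidableEq κ]

theorem matrixRep_apply (ρ : G →* Matrix.unitaryGroup ι ℂ) (g : G) (v : ι → ℂ) :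
    matrixRep ρ g v = (ρ g).1.mulVec v := rfl

/-- A matrix commuting with two matrix representations, as an intertwining map. -/
noncomputable def Matrix.toIntertwiningMap (ρ : G →* Matrix.unitaryGroup ι ℂ)
    (ρ' : G →* Matrix.unitaryGroup κ ℂ) (T : Matrix ι κ ℂ)
    (hT : ∀ g, (ρ g).1 * T = T * (ρ' g).1) :
    Representation.IntertwiningMap (matrixRep ρ') (matrixRep ρ) where
  toLinearMap := Matrix.toLin' T
  isIntertwining' g := by
    refine LinearMap.ext fun v => ?_
    simp only [LinearMap.comp_apply, matrixRep_apply, Matrix.toLin'_apply, Matrix.mulVec_mulVec, hT]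

theorem intertwiner_eq_zero {ρ : G →* Matrix.unitaryGroup ι ℂ} {ρ' : G →* Matrix.unitaryGroup κ ℂ}
    (h : (matrixRep ρ).IsIrreducible) (h' : (matrixRep ρ').IsIrreducible)
    (hne : IsEmpty (Representation.Equiv (matrixRep ρ') (matrixRep ρ))) {T : Matrix ι κ ℂ}
    (hT : ∀ g, (ρ g).1 * T = T * (ρ' g).1) : T = 0 := by
  -- Schur's lemma enters as an instance: `h`, `h'` and `hne` make the space of intertwining maps a
  -- subsingleton.
  have h0 : T.toIntertwiningMap ρ ρ' hT = 0 := Subsingleton.elim _ _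
  have h1 : Matrix.toLin' T = 0 := congrArg (fun f => f.toLinearMap) h0
  simpa using h1

theorem intertwiner_eq_smul_one {ρ : G →* Matrix.unitaryGroup ι ℂ}
    (h : (matrixRep ρ).IsIrreducible) {T : Matrix ι ι ℂ}
    (hT : ∀ g, (ρ g).1 * T = T * (ρ g).1) : ∃ c : ℂ, T = c • (1 : Matrix ι ι ℂ) := by
  obtain ⟨c, hc⟩ := (Representation.IsIrreducible.algebraMap_intertwiningMap_bijective_of_isAlgClosed
    (ρ := matrixRep ρ)).2 (T.toIntertwiningMap ρ ρ hT)
  refine ⟨c, ?_⟩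
  have h1 : Matrix.toLin' T = c • LinearMap.id :=
    (congrArg (fun f => f.toLinearMap) hc).symm
  apply Matrix.toLin'.injective
  rw [h1, map_smul, Matrix.toLin'_one]

variable [Fintype G]

/-- Averaging any matrix over the group produces an intertwiner, to which Schur's lemma applies;
translating the summation index by `g` shows it. -/
theorem sum_conj_comm (ρ : G →* Matrix.unitaryGroup ι ℂ) (ρ' : G →* Matrix.unitaryGroup κ ℂ)
    (X : Matrix ι κ ℂ) (g : G) :
    (ρ g).1 * (∑ h, (ρ h).1 * X * (ρ' h⁻¹).1) = (∑ h, (ρ h).1 * X * (ρ' h⁻¹).1) * (ρ' g).1 := by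
  rw [Matrix.mul_sum, Matrix.sum_mul]
  refine Fintype.sum_equiv (Equiv.mulLeft g) _ _ fun h => ?_
  have h1 : (ρ (g * h)).1 = (ρ g).1 * (ρ h).1 := by rw [map_mul, Submonoid.coe_mul]
  have h2 : (ρ' h⁻¹).1 = (ρ' (g * h)⁻¹).1 * (ρ' g).1 := by
    rw [← Submonoid.coe_mul, ← map_mul]
    simp
  rw [Equiv.coe_mulLeft, h1, h2]
  simp only [Matrix.mul_assoc]

theorem sum_conj_single (ρ : G →* Matrix.unitaryGroup ι ℂ) (ρ' : G →* Matrix.unitaryGroup κ ℂ)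
    (i j : ι) (k l : κ) :
    (∑ h, (ρ h).1 * Matrix.single j k (1 : ℂ) * (ρ' h⁻¹).1) i l =
      ∑ h, (ρ h).1 i j * (ρ' h⁻¹).1 k l := by
  rw [Matrix.sum_apply]
  refine Finset.sum_congr rfl fun h _ => ?_
  rw [Matrix.mul_assoc, Matrix.mul_apply, Finset.sum_eq_single j]
  · simp
  · intro b _ hb
    simp [hb]
  · simp

theorem schur_orthogonality_of_isEmpty {ρ : G →* Matrix.unitaryGroup ι ℂ}
    {ρ' : G →* Matrix.unitaryGroup κ ℂ}
    (h : (matrixRep ρ).IsIrreducible) (h' : (matrixRep ρ').IsIrreducible)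
    (hne : IsEmpty (Representation.Equiv (matrixRep ρ') (matrixRep ρ))) (i j : ι) (k l : κ) :
    ∑ g, (ρ g).1 i j * (ρ' g⁻¹).1 k l = 0 := by
  rw [← sum_conj_single, intertwiner_eq_zero h h' hne (sum_conj_comm ρ ρ' _), Matrix.zero_apply]

/-- The average of the elementary matrix at (j, k) is a scalar by Schur's lemma, and the scalar is
found by comparing traces. -/
theorem schur_orthogonality {ρ : G →* Matrix.unitaryGroup ι ℂ}
    (h : (matrixRep ρ).IsIrreducible) (i j k l : ι) :
    ((Fintype.card ι : ℂ) / Fintype.card G) * ∑ g, (ρ g).1 i j * (ρ g⁻¹).1 k l =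
      if i = l ∧ j = k then 1 else 0 := by
  obtain ⟨c, hc⟩ := intertwiner_eq_smul_one h (sum_conj_comm ρ ρ (Matrix.single j k 1))
  have hG : (Fintype.card G : ℂ) ≠ 0 := by simp
  have hι : (Fintype.card ι : ℂ) ≠ 0 := by
    have : Nonempty ι := ⟨i⟩
    simp
  have htr := congrArg Matrix.trace hc
  have h1 : ∀ g : G, Matrix.trace ((ρ g).1 * Matrix.single j k (1 : ℂ) * (ρ g⁻¹).1) =
      if j = k then 1 else 0 := by
    intro g
    rw [Matrix.trace_mul_comm, ← Matrix.mul_assoc, ← Submonoid.coe_mul, ← map_mul]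
    by_cases hjk : j = k
    · subst hjk; simp
    · simp [hjk]
  rw [Matrix.trace_sum, Finset.sum_congr rfl fun g _ => h1 g, Matrix.trace_smul,
    Matrix.trace_one] at htr
  rw [← sum_conj_single, hc, Matrix.smul_apply, Matrix.one_apply]
  by_cases hjk : j = k
  · simp only [hjk, if_true, Finset.sum_const, Finset.card_univ, nsmul_eq_mul, mul_one,
      smul_eq_mul] at htr
    by_cases hil : i = l
    · simp only [hjk, hil, htr]
      have hc0 : c ≠ 0 := left_ne_zero_of_mul (htr ▸ hG)
      field_simp
      simp
    · simp [hil]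
  · have hc0 : c = 0 := by simpa [hjk, hι, eq_comm] using htr
    simp [hjk, hc0]

/-- The element of the group algebra which acts as the matrix unit `(i, j)` in the unitary
irreducible representation `ρ`. -/
noncomputable def matrixUnit (ρ : G →* Matrix.unitaryGroup ι ℂ) (i j : ι) : MonoidAlgebra ℂ G :=
  ((Fintype.card ι : ℂ) / Fintype.card G) • ∑ τ : G, MonoidAlgebra.single τ ((ρ τ⁻¹).1 j i)

theorem single_mul_matrixUnit (ρ : G →* Matrix.unitaryGroup ι ℂ) (g : G) (i j : ι) :
    MonoidAlgebra.single g 1 * matrixUnit ρ i j = ∑ k, (ρ g).1 k i • matrixUnit ρ k j := by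
  simp only [matrixUnit, mul_smul_comm, Finset.mul_sum, MonoidAlgebra.single_mul_single, one_mul,
    smul_comm _ ((Fintype.card ι : ℂ) / Fintype.card G), ← Finset.smul_sum]
  congr 1
  simp only [Finset.smul_sum]
  rw [Finset.sum_comm]
  refine Fintype.sum_equiv (Equiv.mulLeft g) _ _ fun τ => ?_
  simp only [Equiv.coe_mulLeft, MonoidAlgebra.smul_single, smul_eq_mul]
  rw [← MonoidAlgebra.single_finset_sum]
  congr 1
  have : (ρ τ⁻¹).1 = (ρ (g * τ)⁻¹).1 * (ρ g).1 := by
    rw [← Submonoid.coe_mul, ← map_mul]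
    simp
  rw [this, Matrix.mul_apply]
  simp only [mul_comm]

theorem matrixUnit_mul_single (ρ : G →* Matrix.unitaryGroup ι ℂ) (g : G) (i j : ι) :
    matrixUnit ρ i j * MonoidAlgebra.single g 1 = ∑ k, (ρ g).1 j k • matrixUnit ρ i k := by
  simp only [matrixUnit, smul_mul_assoc, Finset.sum_mul, MonoidAlgebra.single_mul_single, mul_one,
    smul_comm _ ((Fintype.card ι : ℂ) / Fintype.card G), ← Finset.smul_sum]
  congr 1
  simp only [Finset.smul_sum]
  rw [Finset.sum_comm]
  refine Fintype.sum_equiv (Equiv.mulRight g) _ _ fun τ => ?_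
  simp only [Equiv.coe_mulRight, MonoidAlgebra.smul_single, smul_eq_mul]
  rw [← MonoidAlgebra.single_finset_sum]
  congr 1
  have : (ρ τ⁻¹).1 = (ρ g).1 * (ρ (τ * g)⁻¹).1 := by
    rw [← Submonoid.coe_mul, ← map_mul]
    simp
  rw [this, Matrix.mul_apply]

theorem matrixUnit_eq_sum (ρ : G →* Matrix.unitaryGroup ι ℂ) (i j : ι) :
    matrixUnit ρ i j = ∑ τ : G, (((Fintype.card ι : ℂ) / Fintype.card G) * (ρ τ⁻¹).1 j i) •
      MonoidAlgebra.single τ (1 : ℂ) := by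
  simp [matrixUnit, Finset.smul_sum]

/-- Only the left factor is expanded in group elements; these act on the right factor through `ρ`,
and orthogonality evaluates the resulting coefficients. -/
theorem matrixUnit_mul_matrixUnit {ρ : G →* Matrix.unitaryGroup ι ℂ}
    (h : (matrixRep ρ).IsIrreducible) (i j k l : ι) :
    matrixUnit ρ i j * matrixUnit ρ k l = if j = k then matrixUnit ρ i l else 0 := by
  rw [matrixUnit_eq_sum ρ i j, Finset.sum_mul]
  simp only [smul_mul_assoc, single_mul_matrixUnit, Finset.smul_sum, smul_smul]
  rw [Finset.sum_comm]
  simp only [← Finset.sum_smul, mul_assoc, ← Finset.mul_sum, mul_comm ((ρ _⁻¹).1 j i),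
    schur_orthogonality h]
  by_cases hjk : j = k
  · simp [hjk]
  · simp [hjk, Ne.symm hjk]

theorem matrixUnit_mul_matrixUnit_of_isEmpty {ρ : G →* Matrix.unitaryGroup ι ℂ}
    {ρ' : G →* Matrix.unitaryGroup κ ℂ}
    (h : (matrixRep ρ).IsIrreducible) (h' : (matrixRep ρ').IsIrreducible)
    (hne : IsEmpty (Representation.Equiv (matrixRep ρ) (matrixRep ρ'))) (i j : ι) (k l : κ) :
    matrixUnit ρ i j * matrixUnit ρ' k l = 0 := by
  rw [matrixUnit_eq_sum ρ i j, Finset.sum_mul]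
  simp only [smul_mul_assoc, single_mul_matrixUnit, Finset.smul_sum, smul_smul]
  rw [Finset.sum_comm]
  simp only [← Finset.sum_smul, mul_assoc, ← Finset.mul_sum, mul_comm ((ρ _⁻¹).1 j i),
    schur_orthogonality_of_isEmpty h' h hne]
  simp

end SchurOrthogonality

/-! ### Young symmetrizers and their action on Specht modules. -/

section YoungSymmetrizer

open Classical in
/-- The sum of all permutations preserving the rows of a filling. -/
noncomputable def rowSymmetrizer {m : ℕ} {μ : YoungDiagram} (t : Fin m ≃ μ.cells) :
    MonoidAlgebra ℂ (Perm (Fin m)) :=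
  ∑ p : Perm (Fin m) with ∀ i, (t (p i)).1.1 = (t i).1.1, MonoidAlgebra.single p 1

open Classical in
/-- The signed sum of all permutations preserving the columns of a filling. -/
noncomputable def colAntisymmetrizer {m : ℕ} {μ : YoungDiagram} (t : Fin m ≃ μ.cells) :
    MonoidAlgebra ℂ (Perm (Fin m)) :=
  ∑ q : Perm (Fin m) with ∀ i, (t (q i)).1.2 = (t i).1.2,
    MonoidAlgebra.single q ((Perm.sign q : ℤ) : ℂ)

variable {m : ℕ} {μ ν : YoungDiagram}

theorem youngSymmetrizer_eq (t : Fin m ≃ μ.cells) :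
    youngSymmetrizer t = rowSymmetrizer t * colAntisymmetrizer t := rfl

theorem rowSymmetrizer_mul_single (t : Fin m ≃ μ.cells) {p : Perm (Fin m)}
    (hp : ∀ i, (t (p i)).1.1 = (t i).1.1) :
    rowSymmetrizer t * MonoidAlgebra.single p 1 = rowSymmetrizer t := by
  classical
  simp only [rowSymmetrizer, Finset.sum_mul, MonoidAlgebra.single_mul_single, mul_one]
  refine Finset.sum_equiv (Equiv.mulRight p) (fun q => ?_) (fun q _ => rfl)
  simp only [Finset.mem_filter, Finset.mem_univ, true_and, Equiv.coe_mulRight, Perm.mul_apply]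
  constructor
  · intro h i
    rw [h, hp]
  · intro h i
    have := h (p⁻¹ i)
    rw [← hp (p⁻¹ i)] at this
    simpa using this

theorem single_mul_colAntisymmetrizer (t : Fin m ≃ μ.cells) {p : Perm (Fin m)}
    (hp : ∀ i, (t (p i)).1.2 = (t i).1.2) :
    MonoidAlgebra.single p 1 * colAntisymmetrizer t =
      ((Perm.sign p : ℤ) : ℂ) • colAntisymmetrizer t := by
  classical
  simp only [colAntisymmetrizer, Finset.mul_sum, MonoidAlgebra.single_mul_single, one_mul,
    Finset.smul_sum, MonoidAlgebra.smul_single, smul_eq_mul]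
  refine Finset.sum_equiv (Equiv.mulLeft p) (fun q => ?_) (fun q _ => ?_)
  · simp [hp]
  · have h : (Perm.sign p : ℤ) * (Perm.sign p : ℤ) = 1 := by simp [← Units.val_mul]
    have h' : ((Perm.sign p : ℤ) : ℂ) * ((Perm.sign p : ℤ) : ℂ) = 1 := by exact_mod_cast h
    simp [← mul_assoc, h']

theorem colAntisymmetrizer_mul_single (t : Fin m ≃ μ.cells) {p : Perm (Fin m)}
    (hp : ∀ i, (t (p i)).1.2 = (t i).1.2) :
    colAntisymmetrizer t * MonoidAlgebra.single p 1 =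
      ((Perm.sign p : ℤ) : ℂ) • colAntisymmetrizer t := by
  classical
  simp only [colAntisymmetrizer, Finset.sum_mul, MonoidAlgebra.single_mul_single, mul_one,
    Finset.smul_sum, MonoidAlgebra.smul_single, smul_eq_mul]
  refine Finset.sum_equiv (Equiv.mulRight p) (fun q => ?_) (fun q _ => ?_)
  · simp only [Finset.mem_filter, Finset.mem_univ, true_and, Equiv.coe_mulRight, Perm.mul_apply]
    constructor
    · intro h i
      rw [h, hp]
    · intro h i
      have := h (p⁻¹ i)
      rw [← hp (p⁻¹ i)] at this
      simpa using this
  · have h : (Perm.sign p : ℤ) * (Perm.sign p : ℤ) = 1 := by simp [← Units.val_mul]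
    have h' : ((Perm.sign p : ℤ) : ℂ) * ((Perm.sign p : ℤ) : ℂ) = 1 := by exact_mod_cast h
    rw [Equiv.coe_mulRight, Perm.sign_mul, Units.val_mul, Int.cast_mul, mul_left_comm, h', mul_one]

theorem rowSymmetrizer_mul_self (t : Fin m ≃ μ.cells) :
    ∃ c : ℂ, c ≠ 0 ∧ rowSymmetrizer t * rowSymmetrizer t = c • rowSymmetrizer t := by
  classical
  refine ⟨((Finset.univ.filter fun p : Perm (Fin m) =>
    ∀ i, (t (p i)).1.1 = (t i).1.1).card : ℂ), ?_, ?_⟩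
  · rw [Nat.cast_ne_zero, Finset.card_ne_zero]
    exact ⟨1, by simp⟩
  · have : rowSymmetrizer t * rowSymmetrizer t = ∑ p : Perm (Fin m) with
        ∀ i, (t (p i)).1.1 = (t i).1.1, rowSymmetrizer t * MonoidAlgebra.single p 1 := by
      rw [← Finset.mul_sum]
      rfl
    rw [this, Finset.sum_congr rfl fun p hp =>
      rowSymmetrizer_mul_single t (Finset.mem_filter.1 hp).2, Finset.sum_const, Nat.cast_smul_eq_nsmul]

/-- The equation makes `p` preserve columns as well as rows, so `p` fixes every box. -/
theorem eq_inv_of_mul_mul_eq_one (t : Fin m ≃ μ.cells) {q p q' : Perm (Fin m)}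
    (hq : ∀ i, (t (q i)).1.2 = (t i).1.2) (hp : ∀ i, (t (p i)).1.1 = (t i).1.1)
    (hq' : ∀ i, (t (q' i)).1.2 = (t i).1.2) (h : q * (p * q') = 1) : q' = q⁻¹ := by
  have hinv : ∀ {q : Perm (Fin m)}, (∀ i, (t (q i)).1.2 = (t i).1.2) →
      ∀ i, (t (q⁻¹ i)).1.2 = (t i).1.2 := by
    intro q hq i
    rw [← hq (q⁻¹ i)]
    simp
  have hp' : p = q⁻¹ * q'⁻¹ := by
    rw [← mul_assoc, mul_eq_one_iff_eq_inv] at h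
    rw [← h]
    simp
  have hp1 : p = 1 := by
    ext1 i
    apply t.injective
    apply Subtype.ext
    refine Prod.ext (hp i) ?_
    rw [hp', Perm.mul_apply, hinv hq, hinv hq']
    rfl
  rw [hp1, one_mul] at h
  exact (inv_eq_of_mul_eq_one_right h).symm

/-- The coefficient of the identity counts the triples with q p q' = 1, since by `h` each
contributes 1; the triple (1, 1, 1) is among them. -/
theorem sum_single_mul_ne_zero {G : Type*} [Group G] [DecidableEq G] (R C : Finset G) (ε : G → ℂ)
    (h : ∀ q ∈ C, ∀ p ∈ R, ∀ q' ∈ C, q * (p * q') = 1 → ε q * ε q' = 1)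
    (hR : 1 ∈ R) (hC : 1 ∈ C) :
    (∑ q ∈ C, MonoidAlgebra.single q (ε q)) * ((∑ p ∈ R, MonoidAlgebra.single p (1 : ℂ)) *
      ∑ q ∈ C, MonoidAlgebra.single q (ε q)) ≠ 0 := by
  intro h0
  have h1 : (∑ q ∈ C, MonoidAlgebra.single q (ε q)) * ((∑ p ∈ R, MonoidAlgebra.single p (1 : ℂ)) *
      ∑ q ∈ C, MonoidAlgebra.single q (ε q)) = ∑ q ∈ C, ∑ p ∈ R, ∑ q' ∈ C,
      MonoidAlgebra.single (q * (p * q')) (ε q * ε q') := by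
    rw [Finset.sum_mul]
    refine Finset.sum_congr rfl fun q _ => ?_
    rw [Finset.sum_mul, Finset.mul_sum]
    refine Finset.sum_congr rfl fun p _ => ?_
    simp only [Finset.mul_sum, MonoidAlgebra.single_mul_single, one_mul]
  -- Writing the contributions as casts of natural numbers lets the vanishing of the sum force the
  -- vanishing of each term.
  have h2 : ∀ q ∈ C, ∀ p ∈ R, ∀ q' ∈ C, (MonoidAlgebra.single (q * (p * q')) (ε q * ε q')).coeff 1 =
      (((if q * (p * q') = 1 then 1 else 0 : ℕ)) : ℂ) := by
    intro q hq p hp q' hq'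
    rw [MonoidAlgebra.coeff_single, Finsupp.single_apply]
    split_ifs with h1
    · rw [h q hq p hp q' hq' h1, Nat.cast_one]
    · simp
  have h4 := congrArg (fun x : MonoidAlgebra ℂ G => x.coeff 1) (h1.symm.trans h0)
  simp only [MonoidAlgebra.coeff_sum, Finsupp.finsetSum_apply, MonoidAlgebra.coeff_zero,
    Finsupp.zero_apply] at h4
  rw [Finset.sum_congr rfl fun q hq => Finset.sum_congr rfl fun p hp =>
    Finset.sum_congr rfl fun q' hq' => h2 q hq p hp q' hq'] at h4
  norm_cast at h4
  simp only [Finset.sum_eq_zero_iff] at h4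
  have := h4 1 hC 1 hR 1 hC
  simp at this

/-- This serves twice: it shows that the Young symmetrizer is nonzero, and that the column
antisymmetrizer does not annihilate the Specht module. -/
theorem colAntisymmetrizer_mul_youngSymmetrizer_ne_zero (t : Fin m ≃ μ.cells) :
    colAntisymmetrizer t * youngSymmetrizer t ≠ 0 := by
  classical
  refine sum_single_mul_ne_zero _ _ (fun q => ((Perm.sign q : ℤ) : ℂ)) ?_ (by simp) (by simp)
  intro q hq p hp q' hq' h
  simp only [Finset.mem_filter, Finset.mem_univ, true_and] at hq hp hq'
  have h3 : (Perm.sign q : ℤ) * (Perm.sign q : ℤ) = 1 := by simp [← Units.val_mul]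
  rw [eq_inv_of_mul_mul_eq_one t hq hp hq' h, Perm.sign_inv]
  exact_mod_cast h3

variable {G ι : Type} [Group G] [Fintype ι] [DecidableEq ι]

/-- The extension of a matrix representation to the group algebra. -/
noncomputable def matrixAlgHom (ρ : G →* Matrix.unitaryGroup ι ℂ) :
    MonoidAlgebra ℂ G →ₐ[ℂ] Matrix ι ι ℂ :=
  MonoidAlgebra.lift ℂ _ _ ((Matrix.unitaryGroup ι ℂ).subtype.comp ρ)

theorem matrixAlgHom_single (ρ : G →* Matrix.unitaryGroup ι ℂ) (g : G) :
    matrixAlgHom ρ (MonoidAlgebra.single g 1) = (ρ g).1 := by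
  simp [matrixAlgHom]

theorem map_matrixAlgHom_mulVec (ρ : G →* Matrix.unitaryGroup ι ℂ) {A : Type*} [Ring A]
    [Algebra ℂ A] {f : (ι → ℂ) →ₗ[ℂ] A} (F : MonoidAlgebra ℂ G →ₐ[ℂ] A)
    (hf : ∀ g v, f (matrixRep ρ g v) = F (MonoidAlgebra.single g 1) * f v)
    (x : MonoidAlgebra ℂ G) (v : ι → ℂ) :
    f ((matrixAlgHom ρ x).mulVec v) = F x * f v := by
  induction x using MonoidAlgebra.induction_on with
  | of g => simpa [matrixAlgHom_single, matrixRep_apply] using hf g v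
  | add x y hx hy => simp only [map_add, Matrix.add_mulVec, hx, hy, add_mul]
  | smul c x hx => simp only [map_smul, Matrix.smul_mulVec, hx, smul_mul_assoc]

theorem matrixUnit_mul [Fintype G] (ρ : G →* Matrix.unitaryGroup ι ℂ) (i j : ι)
    (x : MonoidAlgebra ℂ G) :
    matrixUnit ρ i j * x = ∑ k, matrixAlgHom ρ x j k • matrixUnit ρ i k := by
  induction x using MonoidAlgebra.induction_on with
  | of g => simpa [matrixAlgHom_single] using matrixUnit_mul_single ρ g i j
  | add x y hx hy => simp only [map_add, mul_add, hx, hy, Matrix.add_apply, add_smul,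
      Finset.sum_add_distrib]
  | smul c x hx => simp only [map_smul, mul_smul_comm, hx, Matrix.smul_apply, Finset.smul_sum,
      smul_smul, smul_eq_mul]

/-- Under the isomorphism `f`, the representation becomes left multiplication on the left ideal of
the Young symmetrizer, so the kernel of the representation is the annihilator of that ideal. -/
theorem IsIrrepOfShape.matrixAlgHom_eq_zero {ρ : Perm (Fin m) →* Matrix.unitaryGroup ι ℂ}
    {t : Fin m ≃ μ.cells} {f : (ι → ℂ) →ₗ[ℂ] MonoidAlgebra ℂ (Perm (Fin m))}
    (hinj : Function.Injective f)
    (hrange : LinearMap.range f = (Ideal.span {youngSymmetrizer t}).restrictScalars ℂ)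
    (hf : ∀ (σ : Perm (Fin m)) (v : ι → ℂ),
      f (matrixRep ρ σ v) = MonoidAlgebra.single σ 1 * f v)
    (x : MonoidAlgebra ℂ (Perm (Fin m))) :
    matrixAlgHom ρ x = 0 ↔ ∀ y, x * (y * youngSymmetrizer t) = 0 := by
  have key := map_matrixAlgHom_mulVec ρ (AlgHom.id ℂ _) hf x
  simp only [AlgHom.id_apply] at key
  constructor
  · intro h y
    have hy : y * youngSymmetrizer t ∈ LinearMap.range f := by
      rw [hrange]
      exact Ideal.mul_mem_left _ _ (Ideal.subset_span rfl)
    obtain ⟨v, hv⟩ := hy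
    rw [← hv, ← key, h, Matrix.zero_mulVec, map_zero]
  · intro h
    ext i j
    have hv : (matrixAlgHom ρ x).mulVec (Pi.single j 1) = 0 := by
      apply hinj
      have hy : f (Pi.single j 1) ∈ LinearMap.range f := ⟨_, rfl⟩
      rw [hrange, Submodule.restrictScalars_mem, Ideal.mem_span_singleton'] at hy
      obtain ⟨y, hy⟩ := hy
      rw [key, map_zero, ← hy, h]
    simpa using congrFun hv i

theorem IsIrrepOfShape.exists_matrixAlgHom_ne_zero
    {ρ : Perm (Fin m) →* Matrix.unitaryGroup ι ℂ} (h : IsIrrepOfShape μ ρ) :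
    ∃ (t : Fin m ≃ μ.cells) (p q : ι), matrixAlgHom ρ (colAntisymmetrizer t) p q ≠ 0 := by
  obtain ⟨-, t, f, hinj, hrange, hf⟩ := h
  by_contra! h0
  have h1 : matrixAlgHom ρ (colAntisymmetrizer t) = 0 := by
    ext i j
    exact h0 t i j
  rw [matrixAlgHom_eq_zero hinj hrange hf] at h1
  exact colAntisymmetrizer_mul_youngSymmetrizer_ne_zero t (by simpa using h1 1)

theorem matrixAlgHom_eq_zero_of_equiv {κ : Type} [Fintype κ] [DecidableEq κ]
    {ρ : G →* Matrix.unitaryGroup ι ℂ} {ρ' : G →* Matrix.unitaryGroup κ ℂ}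
    (e : Representation.Equiv (matrixRep ρ) (matrixRep ρ')) {x : MonoidAlgebra ℂ G}
    (hx : matrixAlgHom ρ' x = 0) : matrixAlgHom ρ x = 0 := by
  have key : ∀ (x : MonoidAlgebra ℂ G) (v : ι → ℂ),
      e ((matrixAlgHom ρ x).mulVec v) = (matrixAlgHom ρ' x).mulVec (e v) := by
    intro x v
    induction x using MonoidAlgebra.induction_on with
    | of g =>
      have := Representation.IntertwiningMap.isIntertwining _ _ e.toIntertwiningMap g v
      simpa [matrixAlgHom_single, matrixRep_apply] using this
    | add x y hx hy => simp only [map_add, Matrix.add_mulVec, hx, hy]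
    | smul c x hx => simp only [map_smul, Matrix.smul_mulVec, hx]
  ext i j
  have hv : (matrixAlgHom ρ x).mulVec (Pi.single j 1) = 0 := by
    apply (EquivLike.injective e)
    rw [key, hx, Matrix.zero_mulVec, map_zero]
  simpa using congrFun hv i

end YoungSymmetrizer

/-! ### Dominance order and inequivalence of different shapes. -/

section Dominance

variable {m : ℕ} {μ ν : YoungDiagram}

/-- Count the entries lying in the first `i` rows of `u` according to their column `c` in `v`. By
`h` those in one column have distinct rows in `u`, so there are at most min(i, length of column c)
of them, which is exactly the number of boxes that column `c` of `ν` has in the first `i` rows. -/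
theorem YoungDiagram.card_filter_row_lt_le (u : Fin m ≃ μ.cells) (v : Fin m ≃ ν.cells)
    (h : ∀ x y, (u x).1.1 = (u y).1.1 → (v x).1.2 = (v y).1.2 → x = y) (i : ℕ) :
    (μ.cells.filter fun c => c.1 < i).card ≤ (ν.cells.filter fun c => c.1 < i).card := by
  set X := Finset.univ.filter fun x : Fin m => (u x).1.1 < i with hX
  have h1 : (μ.cells.filter fun c => c.1 < i).card = X.card := by
    symm
    refine Finset.card_bij (fun x _ => (u x).1) ?_ ?_ ?_
    · intro x hx
      simpa [hX] using hx
    · intro x _ y _ hxy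
      exact u.injective (Subtype.ext hxy)
    · intro c hc
      rw [Finset.mem_filter] at hc
      exact ⟨u.symm ⟨c, hc.1⟩, by simpa [hX] using hc.2, by simp⟩
  rw [h1, Finset.card_eq_sum_card_fiberwise (f := fun x => (v x).1.2) (t := ν.cells.image Prod.snd),
    Finset.card_eq_sum_card_fiberwise (f := Prod.snd) (t := ν.cells.image Prod.snd)
      (s := ν.cells.filter fun c => c.1 < i)]
  · refine Finset.sum_le_sum fun c _ => ?_
    have h2 : (Finset.filter (fun a => a.2 = c) (ν.cells.filter fun c => c.1 < i)).card =
        min i (ν.colLen c) := by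
      rw [← Finset.card_range (min i (ν.colLen c))]
      refine Finset.card_bij (fun a _ => a.1) ?_ ?_ ?_
      · rintro ⟨a, b⟩ hab
        simp only [Finset.mem_filter] at hab
        obtain ⟨⟨h3, h4⟩, rfl⟩ := hab
        simp only [Finset.mem_range, lt_min_iff]
        exact ⟨h4, YoungDiagram.mem_iff_lt_colLen.1 h3⟩
      · rintro ⟨a, b⟩ hab ⟨a', b'⟩ hab' h5
        simp only [Finset.mem_filter] at hab hab'
        exact Prod.ext h5 (hab.2.trans hab'.2.symm)
      · intro a ha
        simp only [Finset.mem_range, lt_min_iff] at ha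
        refine ⟨(a, c), ?_, rfl⟩
        simp only [Finset.mem_filter, and_true]
        exact ⟨YoungDiagram.mem_iff_lt_colLen.2 ha.2, ha.1⟩
    rw [h2, le_min_iff]
    constructor
    · rw [← Finset.card_range i]
      refine Finset.card_le_card_of_injOn (fun x => (u x).1.1) ?_ ?_
      · intro x hx
        simp only [hX, Finset.coe_filter, Finset.mem_filter, Set.mem_ofPred_eq] at hx
        simpa using hx.1.2
      · intro x hx y hy hxy
        simp only [Finset.coe_filter, Set.mem_ofPred_eq] at hx hy
        exact h x y hxy (hx.2.trans hy.2.symm)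
    · rw [← Finset.card_range (ν.colLen c)]
      refine Finset.card_le_card_of_injOn (fun x => (v x).1.1) ?_ ?_
      · intro x hx
        simp only [Finset.coe_filter, Set.mem_ofPred_eq] at hx
        simp only [Finset.coe_range, Set.mem_Iio]
        rw [← YoungDiagram.mem_iff_lt_colLen, ← hx.2]
        exact (v x).2
      · intro x hx y hy hxy
        simp only [Finset.coe_filter, Set.mem_ofPred_eq] at hx hy
        exact v.injective (Subtype.ext (Prod.ext hxy (hx.2.trans hy.2.symm)))
  · intro a ha
    simp only [Finset.coe_filter, Set.mem_ofPred_eq] at ha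
    exact Finset.mem_image_of_mem _ ha.1
  · intro x _
    exact Finset.mem_image_of_mem _ (v x).2

theorem YoungDiagram.card_filter_row_lt_succ (μ : YoungDiagram) (i : ℕ) :
    (μ.cells.filter fun c => c.1 < i + 1).card =
      (μ.cells.filter fun c => c.1 < i).card + μ.rowLen i := by
  rw [YoungDiagram.rowLen_eq_card, ← Finset.card_union_of_disjoint]
  · congr 1
    ext c
    simp only [Finset.mem_filter, Finset.mem_union, YoungDiagram.mem_row_iff,
      YoungDiagram.mem_cells, Nat.lt_succ_iff_lt_or_eq]
    tauto
  · rw [Finset.disjoint_left]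
    intro c hc hc'
    rw [Finset.mem_filter] at hc
    rw [YoungDiagram.mem_row_iff] at hc'
    omega

theorem YoungDiagram.eq_of_card_filter_row_lt
    (h : ∀ i, (μ.cells.filter fun c => c.1 < i).card = (ν.cells.filter fun c => c.1 < i).card) :
    μ = ν := by
  apply SetLike.ext
  rintro ⟨a, b⟩
  have h1 := h (a + 1)
  rw [card_filter_row_lt_succ, card_filter_row_lt_succ, h a, Nat.add_left_cancel_iff] at h1
  rw [mem_iff_lt_rowLen, mem_iff_lt_rowLen, h1]

/-- The transposition of `x` and `y` is absorbed by the row symmetrizer; moved past `g` it becomes a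
column transposition, which costs a sign. The product equals its own negative. -/
theorem rowSymmetrizer_mul_single_mul_colAntisymmetrizer (t : Fin m ≃ μ.cells)
    (s : Fin m ≃ ν.cells) (g : Perm (Fin m)) {x y : Fin m} (hxy : x ≠ y)
    (hrow : (t x).1.1 = (t y).1.1) (hcol : (s (g⁻¹ x)).1.2 = (s (g⁻¹ y)).1.2) :
    rowSymmetrizer t * MonoidAlgebra.single g 1 * colAntisymmetrizer s = 0 := by
  have h1 : rowSymmetrizer t * MonoidAlgebra.single (swap x y) 1 = rowSymmetrizer t := by
    apply rowSymmetrizer_mul_single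
    intro i
    rcases eq_or_ne i x with rfl | hx
    · rw [swap_apply_left, hrow]
    rcases eq_or_ne i y with rfl | hy
    · rw [swap_apply_right, hrow]
    rw [swap_apply_of_ne_of_ne hx hy]
  have h2 : MonoidAlgebra.single (swap (g⁻¹ x) (g⁻¹ y)) 1 * colAntisymmetrizer s =
      -colAntisymmetrizer s := by
    rw [single_mul_colAntisymmetrizer, Perm.sign_swap (by simpa using hxy)]
    · simp
    intro i
    rcases eq_or_ne i (g⁻¹ x) with rfl | hx
    · rw [swap_apply_left, hcol]
    rcases eq_or_ne i (g⁻¹ y) with rfl | hy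
    · rw [swap_apply_right, hcol]
    rw [swap_apply_of_ne_of_ne hx hy]
  have h3 : swap x y * g = g * swap (g⁻¹ x) (g⁻¹ y) := by
    rw [mul_swap_eq_swap_mul]
    simp
  have h4 : rowSymmetrizer t * MonoidAlgebra.single g 1 * colAntisymmetrizer s =
      -(rowSymmetrizer t * MonoidAlgebra.single g 1 * colAntisymmetrizer s) := by
    conv_lhs => rw [← h1, mul_assoc (rowSymmetrizer t), MonoidAlgebra.single_mul_single, h3,
      mul_one, ← mul_one (1 : ℂ), ← MonoidAlgebra.single_mul_single, mul_assoc, mul_assoc, h2]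
    rw [mul_neg, mul_neg, mul_assoc]
  rw [eq_neg_iff_add_eq_zero, ← two_smul ℂ] at h4
  exact (smul_eq_zero.1 h4).resolve_left two_ne_zero

variable {ι κ : Type} [Fintype ι] [DecidableEq ι] [Fintype κ] [DecidableEq κ]
  {ρ : Perm (Fin m) →* Matrix.unitaryGroup ι ℂ} {ρ' : Perm (Fin m) →* Matrix.unitaryGroup κ ℂ}

/-- If the inequality failed, every pair of fillings would have two entries in a common row of one
and a common column of the other, so the row symmetrizer of `t` would annihilate the Specht module
of `ν`, hence also that of `μ`. But the row symmetrizer only rescales the Young symmetrizer of `t`,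
by a nonzero factor. -/
theorem IsIrrepOfShape.card_filter_row_lt_le (h : IsIrrepOfShape μ ρ) (h' : IsIrrepOfShape ν ρ')
    (e : Representation.Equiv (matrixRep ρ) (matrixRep ρ')) (i : ℕ) :
    (μ.cells.filter fun c => c.1 < i).card ≤ (ν.cells.filter fun c => c.1 < i).card := by
  obtain ⟨-, t, f, hinj, hrange, hf⟩ := h
  obtain ⟨-, s, f', hinj', hrange', hf'⟩ := h'
  by_contra hlt
  have h1 : ∀ z, rowSymmetrizer t * z * colAntisymmetrizer s = 0 := by
    intro z
    induction z using MonoidAlgebra.induction_on with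
    | of g =>
      have h2 : ∃ x y, (t x).1.1 = (t y).1.1 ∧ (s (g⁻¹ x)).1.2 = (s (g⁻¹ y)).1.2 ∧ x ≠ y := by
        by_contra! h3
        exact hlt (YoungDiagram.card_filter_row_lt_le t ((g⁻¹ : Perm (Fin m)).trans s) h3 i)
      obtain ⟨x, y, hrow, hcol, hxy⟩ := h2
      exact rowSymmetrizer_mul_single_mul_colAntisymmetrizer t s g hxy hrow hcol
    | add x y hx hy => rw [mul_add, add_mul, hx, hy, add_zero]
    | smul c x hx => rw [mul_smul_comm, smul_mul_assoc, hx, smul_zero]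
  have h2 : matrixAlgHom ρ' (rowSymmetrizer t) = 0 := by
    rw [matrixAlgHom_eq_zero hinj' hrange' hf']
    intro y
    rw [youngSymmetrizer_eq, ← mul_assoc y, ← mul_assoc, h1]
  have h3 := matrixAlgHom_eq_zero_of_equiv e h2
  rw [matrixAlgHom_eq_zero hinj hrange hf] at h3
  have h4 := h3 1
  obtain ⟨c, hc, hcc⟩ := rowSymmetrizer_mul_self t
  rw [one_mul, youngSymmetrizer_eq, ← mul_assoc, hcc, smul_mul_assoc, ← youngSymmetrizer_eq] at h4
  apply colAntisymmetrizer_mul_youngSymmetrizer_ne_zero t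
  rw [(smul_eq_zero.1 h4).resolve_left hc, mul_zero]

/-- An equivalence makes each shape dominate the other, and dominance is antisymmetric. -/
theorem IsIrrepOfShape.isEmpty_equiv (h : IsIrrepOfShape μ ρ) (h' : IsIrrepOfShape ν ρ')
    (hne : μ ≠ ν) : IsEmpty (Representation.Equiv (matrixRep ρ) (matrixRep ρ')) :=
  ⟨fun e => hne (YoungDiagram.eq_of_card_filter_row_lt fun i =>
    le_antisymm (h.card_filter_row_lt_le h' e i) (h'.card_filter_row_lt_le h e.symm i))⟩

end Dominance

/-! ### Young's lattice and the identity ∑ d_μ² = n!. -/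

section YoungLattice

namespace YoungDiagram

variable {κ μ ρ : YoungDiagram}

theorem card_le_card_of_le (h : κ ≤ μ) : κ.card ≤ μ.card :=
  Finset.card_le_card (cells_subset_iff.2 h)

theorem eq_of_le_of_card_le (h : κ ≤ μ) (hc : μ.card ≤ κ.card) : κ = μ :=
  YoungDiagram.ext (Finset.eq_of_subset_of_card_le (cells_subset_iff.2 h) hc)

/-- Removal of a maximal box. -/
def eraseBox (μ : YoungDiagram) (c : ℕ × ℕ) (hc : ∀ x ∈ μ, c ≤ x → x = c) : YoungDiagram where
  cells := μ.cells.erase c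
  isLowerSet := by
    intro a b hba ha
    simp only [Finset.coe_erase, Set.mem_sdiff, Finset.mem_coe, mem_cells, Set.mem_singleton_iff]
      at ha ⊢
    refine ⟨μ.isLowerSet hba ha.1, ?_⟩
    rintro rfl
    exact ha.2 (hc a ha.1 hba)

/-- Addition of a minimal box. -/
def insertBox (μ : YoungDiagram) (c : ℕ × ℕ) (hc : ∀ x, x < c → x ∈ μ) : YoungDiagram where
  cells := insert c μ.cells
  isLowerSet := by
    intro a b hba ha
    simp only [Finset.coe_insert, Set.mem_insert_iff, Finset.mem_coe, mem_cells] at ha ⊢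
    rcases ha with rfl | ha
    · rcases hba.eq_or_lt with h | h
      · exact Or.inl h
      · exact Or.inr (hc b h)
    · exact Or.inr (μ.isLowerSet hba ha)

/-- A maximal box of μ \ κ is maximal in `μ`; removing it leaves a diagram between `κ` and `μ`,
which must be `κ`. -/
theorem card_eq_of_covBy (h : κ ⋖ μ) : μ.card = κ.card + 1 := by
  have hne : (μ.cells \ κ.cells).Nonempty :=
    Finset.sdiff_nonempty.2 (cells_ssubset_iff.2 h.lt).2
  obtain ⟨c, hc⟩ := (μ.cells \ κ.cells).exists_maximal hne
  have hcμ := Finset.mem_sdiff.1 hc.1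
  have hmax : ∀ x ∈ μ, c ≤ x → x = c := by
    intro x hx hcx
    refine le_antisymm (hc.2 (Finset.mem_sdiff.2 ⟨hx, fun hxκ => ?_⟩) hcx) hcx
    exact hcμ.2 (κ.isLowerSet hcx hxκ)
  have h1 : κ ≤ μ.eraseBox c hmax := by
    rw [← cells_subset_iff]
    intro x hx
    refine Finset.mem_erase.2 ⟨?_, cells_subset_iff.2 h.le hx⟩
    rintro rfl
    exact hcμ.2 hx
  have h2 : μ.eraseBox c hmax < μ := by
    rw [← cells_ssubset_iff]
    exact Finset.erase_ssubset hcμ.1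
  have h3 : κ = μ.eraseBox c hmax := (h1.eq_or_lt).resolve_right fun h4 => h.2 h4 h2
  rw [h3]
  exact (Finset.card_erase_add_one hcμ.1).symm

theorem covBy_of_le_of_card_eq (h : κ ≤ μ) (hc : μ.card = κ.card + 1) : κ ⋖ μ := by
  refine ⟨lt_of_le_of_ne h ?_, fun ρ h1 h2 => ?_⟩
  · rintro rfl
    omega
  · have h3 := Finset.card_lt_card (cells_ssubset_iff.2 h1)
    have h4 := Finset.card_lt_card (cells_ssubset_iff.2 h2)
    change κ.card < ρ.card at h3
    change ρ.card < μ.card at h4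
    omega

theorem colLen_zero_le_card (μ : YoungDiagram) : μ.colLen 0 ≤ μ.card := by
  rw [colLen_eq_card]
  exact Finset.card_le_card (Finset.filter_subset _ _)

theorem mem_youngDiagrams {m d : ℕ} : μ ∈ youngDiagrams m d ↔ μ.card = m ∧ μ.colLen 0 ≤ d := by
  simp [youngDiagrams]

theorem mem_youngDiagrams_self {m : ℕ} : μ ∈ youngDiagrams m m ↔ μ.card = m := by
  rw [mem_youngDiagrams, and_iff_left_iff_imp]
  rintro rfl
  exact μ.colLen_zero_le_card

open Classical in
/-- The diagrams covering `κ`. -/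
noncomputable def upperCovers (κ : YoungDiagram) : Finset YoungDiagram :=
  (youngDiagrams (κ.card + 1) (κ.card + 1)).filter fun μ => κ ⋖ μ

open Classical in
/-- The diagrams covered by `μ`. -/
noncomputable def lowerCovers (μ : YoungDiagram) : Finset YoungDiagram :=
  (youngDiagrams (μ.card - 1) (μ.card - 1)).filter fun κ => κ ⋖ μ

@[simp]
theorem mem_upperCovers : μ ∈ κ.upperCovers ↔ κ ⋖ μ := by
  simp only [upperCovers, Finset.mem_filter, mem_youngDiagrams_self, and_iff_right_iff_imp]
  exact card_eq_of_covBy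

@[simp]
theorem mem_lowerCovers : κ ∈ μ.lowerCovers ↔ κ ⋖ μ := by
  simp only [lowerCovers, Finset.mem_filter, mem_youngDiagrams_self, and_iff_right_iff_imp]
  intro h
  have := card_eq_of_covBy h
  omega

theorem exists_cells_eq_insert (h : κ ⋖ μ) : ∃ c, c ∉ κ ∧ μ.cells = insert c κ.cells := by
  have h1 := card_eq_of_covBy h
  have h2 := Finset.card_sdiff_add_card_eq_card (cells_subset_iff.2 h.le)
  change _ + κ.card = μ.card at h2
  obtain ⟨c, hc⟩ := Finset.card_eq_one.1 (show (μ.cells \ κ.cells).card = 1 by omega)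
  refine ⟨c, ?_, ?_⟩
  · have : c ∈ μ.cells \ κ.cells := by simp [hc]
    exact (Finset.mem_sdiff.1 this).2
  · rw [← Finset.singleton_union, ← hc, Finset.sdiff_union_of_subset (cells_subset_iff.2 h.le)]

/-- The rows of `κ` to which a box can be added. -/
def addableRows (κ : YoungDiagram) : Finset ℕ :=
  (Finset.range (κ.colLen 0 + 1)).filter fun i => i = 0 ∨ κ.rowLen i < κ.rowLen (i - 1)

/-- The rows of `κ` from which a box can be removed. -/
def removableRows (κ : YoungDiagram) : Finset ℕ :=
  (Finset.range (κ.colLen 0)).filter fun i => κ.rowLen (i + 1) < κ.rowLen i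

/-- Below each removable row lies an addable one, and row 0 is the one addable row not obtained in
this way. -/
theorem card_addableRows (κ : YoungDiagram) :
    κ.addableRows.card = κ.removableRows.card + 1 := by
  have h : κ.addableRows = insert 0 (κ.removableRows.map ⟨Nat.succ, Nat.succ_injective⟩) := by
    ext i
    rcases i with _ | i
    · simp [addableRows]
    · simp [addableRows, removableRows]
  rw [h, Finset.card_insert_of_notMem (by simp), Finset.card_map]

theorem mem_of_lt_of_mem_addableRows {i : ℕ} (hi : i ∈ κ.addableRows) :
    ∀ x, x < (i, κ.rowLen i) → x ∈ κ := by
  rintro ⟨a, b⟩ hab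
  simp only [addableRows, Finset.mem_filter] at hi
  rw [Prod.mk_lt_mk] at hab
  rw [mem_iff_lt_rowLen]
  rcases hab with ⟨h1, h2⟩ | ⟨h1, h2⟩
  · have h3 := κ.rowLen_anti a (i - 1) (by omega)
    omega
  · exact h2.trans_le (κ.rowLen_anti a i h1)

theorem eq_of_le_of_mem_removableRows {i : ℕ} (hi : i ∈ κ.removableRows) :
    ∀ x ∈ κ, (i, κ.rowLen i - 1) ≤ x → x = (i, κ.rowLen i - 1) := by
  rintro ⟨a, b⟩ hab h
  simp only [removableRows, Finset.mem_filter] at hi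
  rw [Prod.mk_le_mk] at h
  rw [mem_iff_lt_rowLen] at hab
  have ha : a = i := by
    by_contra hne
    have := κ.rowLen_anti (i + 1) a (by omega)
    omega
  subst ha
  ext <;> simp
  omega

theorem card_upperCovers_eq_card_addableRows (κ : YoungDiagram) :
    κ.upperCovers.card = κ.addableRows.card := by
  symm
  refine Finset.card_bij (fun i hi => κ.insertBox (i, κ.rowLen i)
    (mem_of_lt_of_mem_addableRows hi)) ?_ ?_ ?_
  · intro i hi
    rw [mem_upperCovers]
    refine covBy_of_le_of_card_eq ?_ ?_
    · rw [← cells_subset_iff]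
      exact Finset.subset_insert _ _
    · exact Finset.card_insert_of_notMem (by simp [mem_iff_lt_rowLen])
  · intro i hi j hj hij
    have h1 : (i, κ.rowLen i) ∈ insert (j, κ.rowLen j) κ.cells := by
      have h2 := congrArg cells hij
      simp only [insertBox] at h2
      rw [← h2]
      exact Finset.mem_insert_self _ _
    rw [Finset.mem_insert] at h1
    rcases h1 with h1 | h1
    · exact (Prod.mk.inj h1).1
    · simp [mem_iff_lt_rowLen] at h1
  · intro μ hμ
    rw [mem_upperCovers] at hμ
    obtain ⟨⟨i, j⟩, hc, hμc⟩ := exists_cells_eq_insert hμ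
    have hmem : ∀ x, x ∈ μ ↔ x = (i, j) ∨ x ∈ κ := by
      intro x
      rw [← mem_cells, hμc, Finset.mem_insert, mem_cells]
    have hij : (i, j) ∈ μ := (hmem _).2 (Or.inl rfl)
    rw [mem_iff_lt_rowLen, not_lt] at hc
    have hj : j = κ.rowLen i := by
      by_contra hne
      have h1 := (hmem (i, j - 1)).1 (μ.up_left_mem le_rfl (by omega) hij)
      rw [mem_iff_lt_rowLen, Prod.mk_inj] at h1
      omega
    have hi : i ∈ κ.addableRows := by
      simp only [addableRows, Finset.mem_filter, Finset.mem_range]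
      rcases i with _ | i
      · simp
      · have h1 := (hmem (i, j)).1 (μ.up_left_mem (by omega) le_rfl hij)
        have h2 : (i, j) ∈ κ := h1.resolve_left (by simp)
        have h3 : (i, 0) ∈ κ := κ.up_left_mem le_rfl (by omega) h2
        rw [mem_iff_lt_rowLen] at h2
        rw [mem_iff_lt_colLen] at h3
        simp only [Nat.add_sub_cancel]
        omega
    refine ⟨i, hi, ?_⟩
    apply YoungDiagram.ext
    rw [hμc, hj]
    rfl

theorem card_lowerCovers_eq_card_removableRows (κ : YoungDiagram) :
    κ.lowerCovers.card = κ.removableRows.card := by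
  have hbox : ∀ i ∈ κ.removableRows, (i, κ.rowLen i - 1) ∈ κ := by
    intro i hi
    simp only [removableRows, Finset.mem_filter] at hi
    rw [mem_iff_lt_rowLen]
    omega
  symm
  refine Finset.card_bij (fun i hi => κ.eraseBox (i, κ.rowLen i - 1)
    (eq_of_le_of_mem_removableRows hi)) ?_ ?_ ?_
  · intro i hi
    rw [mem_lowerCovers]
    refine covBy_of_le_of_card_eq ?_ ?_
    · rw [← cells_subset_iff]
      exact Finset.erase_subset _ _
    · exact (Finset.card_erase_add_one (hbox i hi)).symm
  · intro i hi j hj hij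
    have h2 := congrArg cells hij
    simp only [eraseBox] at h2
    by_contra hne
    have h1 : (i, κ.rowLen i - 1) ∈ κ.cells.erase (j, κ.rowLen j - 1) :=
      Finset.mem_erase.2 ⟨fun h => hne (Prod.mk.inj h).1, hbox i hi⟩
    rw [← h2] at h1
    simp at h1
  · intro ρ hρ
    rw [mem_lowerCovers] at hρ
    obtain ⟨⟨i, j⟩, hc, hκc⟩ := exists_cells_eq_insert hρ
    have hmem : ∀ x, x ∈ κ ↔ x = (i, j) ∨ x ∈ ρ := by
      intro x
      rw [← mem_cells, hκc, Finset.mem_insert, mem_cells]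
    have hij : (i, j) ∈ κ := (hmem _).2 (Or.inl rfl)
    have hlt := mem_iff_lt_rowLen.1 hij
    have hj : j = κ.rowLen i - 1 := by
      by_contra hne
      have h1 := (hmem (i, j + 1)).1 (mem_iff_lt_rowLen.2 (by omega))
      have h2 : (i, j + 1) ∈ ρ := h1.resolve_left (by simp)
      exact hc (ρ.up_left_mem le_rfl (by omega) h2)
    have hi : i ∈ κ.removableRows := by
      simp only [removableRows, Finset.mem_filter, Finset.mem_range]
      refine ⟨mem_iff_lt_colLen.1 (κ.up_left_mem le_rfl (by omega) hij), ?_⟩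
      by_contra hle
      have h1 := (hmem (i + 1, j)).1 (mem_iff_lt_rowLen.2 (by omega))
      have h2 : (i + 1, j) ∈ ρ := h1.resolve_left (by simp)
      exact hc (ρ.up_left_mem (by omega) le_rfl h2)
    refine ⟨i, hi, ?_⟩
    apply YoungDiagram.ext
    change κ.cells.erase (i, κ.rowLen i - 1) = ρ.cells
    rw [← hj, hκc, Finset.erase_insert (by simpa using hc)]

theorem card_upperCovers (κ : YoungDiagram) : κ.upperCovers.card = κ.lowerCovers.card + 1 := by
  rw [card_upperCovers_eq_card_addableRows, card_lowerCovers_eq_card_removableRows,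
    card_addableRows]

theorem card_inf_add_card_sup (κ ρ : YoungDiagram) :
    (κ ⊓ ρ).card + (κ ⊔ ρ).card = κ.card + ρ.card :=
  Finset.card_inter_add_card_union _ _

/-- Two distinct diagrams have at most one common upper cover, their join, and it exists exactly
when their meet is a common lower cover. This is the exchange on which the hook-free dimension count
rests. -/
theorem covBy_iff_of_ne (hne : κ ≠ ρ) : (κ ⋖ μ ∧ ρ ⋖ μ) ↔
    (μ = κ ⊔ ρ ∧ κ ⊓ ρ ⋖ κ ∧ κ ⊓ ρ ⋖ ρ) := by
  have h0 := card_inf_add_card_sup κ ρ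
  constructor
  · rintro ⟨h1, h2⟩
    have h3 : κ ⊔ ρ = μ := h1.wcovBy.sup_eq h2.wcovBy hne
    have h4 := card_eq_of_covBy h1
    have h5 := card_eq_of_covBy h2
    rw [h3] at h0
    exact ⟨h3.symm, covBy_of_le_of_card_eq inf_le_left (by omega),
      covBy_of_le_of_card_eq inf_le_right (by omega)⟩
  · rintro ⟨rfl, h1, h2⟩
    have h4 := card_eq_of_covBy h1
    have h5 := card_eq_of_covBy h2
    exact ⟨covBy_of_le_of_card_eq le_sup_left (by omega),
      covBy_of_le_of_card_eq le_sup_right (by omega)⟩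

theorem covBy_iff_of_ne' (hne : κ ≠ ρ) {τ : YoungDiagram} : (τ ⋖ κ ∧ τ ⋖ ρ) ↔
    (τ = κ ⊓ ρ ∧ κ ⋖ κ ⊔ ρ ∧ ρ ⋖ κ ⊔ ρ) := by
  constructor
  · rintro ⟨h1, h2⟩
    have h3 : κ ⊓ ρ = τ := by
      rcases h1.eq_or_eq (le_inf h1.le h2.le) inf_le_left with h | h
      · exact h
      · have hle : κ ≤ ρ := inf_eq_left.1 h
        have h4 := card_eq_of_covBy h1
        have h5 := card_eq_of_covBy h2
        exact absurd (eq_of_le_of_card_le hle (by omega)) hne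
    subst h3
    exact ⟨rfl, (covBy_iff_of_ne hne).2 ⟨rfl, h1, h2⟩⟩
  · rintro ⟨rfl, h⟩
    exact ((covBy_iff_of_ne hne).1 h).2

theorem card_bot : (⊥ : YoungDiagram).card = 0 := rfl

theorem eq_bot_of_card_eq_zero (h : κ.card = 0) : κ = ⊥ :=
  (eq_of_le_of_card_le bot_le (by rw [h]; exact Nat.zero_le _)).symm

end YoungDiagram

open YoungDiagram

theorem YoungPath.le {α μ : YoungDiagram} (p : YoungPath α μ) : α ≤ μ := by
  induction p with
  | nil => exact le_rfl
  | cons p h ih => exact ih.trans h.le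

theorem card_youngIndex_bot : Fintype.card (YoungIndex ⊥) = 1 := by
  rw [Fintype.card_eq_one_iff]
  refine ⟨YoungPath.nil, fun p => ?_⟩
  cases p with
  | nil => rfl
  | cons p h => exact absurd h.lt not_lt_bot

theorem card_youngIndex_eq_sum {μ : YoungDiagram} (hμ : μ ≠ ⊥) :
    Fintype.card (YoungIndex μ) = ∑ κ ∈ μ.lowerCovers, Fintype.card (YoungIndex κ) := by
  classical
  rw [← Finset.sum_coe_sort, ← Fintype.card_sigma]
  symm
  refine Fintype.card_congr (Equiv.ofBijective
    (fun x => YoungPath.cons x.2 (mem_lowerCovers.1 x.1.2)) ⟨?_, ?_⟩)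
  · rintro ⟨⟨κ, hκ⟩, p⟩ ⟨⟨κ', hκ'⟩, p'⟩ h
    simp only at h
    cases h
    rfl
  · intro p
    cases p with
    | nil => exact absurd rfl hμ
    | cons p h => exact ⟨⟨⟨_, mem_lowerCovers.2 h⟩, p⟩, rfl⟩

/-- Young's lattice is a differential poset: going up and then down reaches each ρ ≠ κ in as many
ways as going down and then up, and reaches `κ` itself once more. Together with the branching rule
for path counts this gives the induction step. -/
theorem sum_upperCovers_card_youngIndex (n : ℕ) : ∀ κ : YoungDiagram, κ.card = n →
    ∑ μ ∈ κ.upperCovers, Fintype.card (YoungIndex μ) = (n + 1) * Fintype.card (YoungIndex κ) := by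
  classical
  set f := fun μ : YoungDiagram => Fintype.card (YoungIndex μ) with hf
  induction n using Nat.strong_induction_on with
  | _ n ih =>
  intro κ hκ
  have hup : ∀ μ ∈ κ.upperCovers, f μ = f κ + ∑ ρ ∈ μ.lowerCovers.erase κ, f ρ := by
    intro μ hμ
    rw [mem_upperCovers] at hμ
    have hne : μ ≠ ⊥ := by
      rintro rfl
      exact not_lt_bot hμ.lt
    rw [Finset.add_sum_erase _ f (mem_lowerCovers.2 hμ)]
    exact card_youngIndex_eq_sum hne
  have hdown : ∀ τ ∈ κ.lowerCovers, n * f τ = f κ + ∑ ρ ∈ τ.upperCovers.erase κ, f ρ := by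
    intro τ hτ
    rw [mem_lowerCovers] at hτ
    have hc := card_eq_of_covBy hτ
    rw [Finset.add_sum_erase _ f (mem_upperCovers.2 hτ), ih τ.card (by omega) τ rfl, ← hκ, hc]
  have hexch : ∑ μ ∈ κ.upperCovers, ∑ ρ ∈ μ.lowerCovers.erase κ, f ρ =
      ∑ τ ∈ κ.lowerCovers, ∑ ρ ∈ τ.upperCovers.erase κ, f ρ := by
    rw [Finset.sum_sigma', Finset.sum_sigma']
    refine Finset.sum_bij' (fun x _ => ⟨κ ⊓ x.2, x.2⟩) (fun x _ => ⟨κ ⊔ x.2, x.2⟩) ?_ ?_ ?_ ?_ ?_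
    · rintro ⟨μ, ρ⟩ h
      simp only [Finset.mem_sigma, Finset.mem_erase, mem_upperCovers, mem_lowerCovers] at h ⊢
      obtain ⟨h1, hne, h2⟩ := h
      exact ⟨((covBy_iff_of_ne hne.symm).1 ⟨h1, h2⟩).2.1, hne,
        ((covBy_iff_of_ne hne.symm).1 ⟨h1, h2⟩).2.2⟩
    · rintro ⟨τ, ρ⟩ h
      simp only [Finset.mem_sigma, Finset.mem_erase, mem_upperCovers, mem_lowerCovers] at h ⊢
      obtain ⟨h1, hne, h2⟩ := h
      exact ⟨((covBy_iff_of_ne' hne.symm).1 ⟨h1, h2⟩).2.1, hne,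
        ((covBy_iff_of_ne' hne.symm).1 ⟨h1, h2⟩).2.2⟩
    · rintro ⟨μ, ρ⟩ h
      simp only [Finset.mem_sigma, Finset.mem_erase, mem_upperCovers, mem_lowerCovers] at h
      obtain ⟨h1, hne, h2⟩ := h
      simp only [((covBy_iff_of_ne hne.symm).1 ⟨h1, h2⟩).1]
    · rintro ⟨τ, ρ⟩ h
      simp only [Finset.mem_sigma, Finset.mem_erase, mem_upperCovers, mem_lowerCovers] at h
      obtain ⟨h1, hne, h2⟩ := h
      simp only [((covBy_iff_of_ne' hne.symm).1 ⟨h1, h2⟩).1]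
    · intro x _
      rfl
  have hsum : n * ∑ τ ∈ κ.lowerCovers, f τ = n * f κ := by
    -- The branching rule fails for the empty diagram, but there the factor `n` is 0.
    rcases eq_or_ne κ ⊥ with rfl | hne
    · rw [card_bot] at hκ
      simp [← hκ]
    · rw [hf, ← card_youngIndex_eq_sum hne]
  have h1 := Finset.sum_congr rfl hup
  have h2 := Finset.sum_congr rfl hdown
  rw [Finset.sum_add_distrib, Finset.sum_const, smul_eq_mul] at h1 h2
  rw [← Finset.mul_sum, hsum] at h2
  have h3 := card_upperCovers κ
  rw [h1, hexch, h3, add_mul, add_mul, h2]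
  ring

/-- Double counting over covering pairs: summing d_μ d_κ below each `μ` gives d_μ², and above each
`κ` it gives (n + 1) d_κ². -/
theorem sum_card_youngIndex_sq (n : ℕ) :
    ∑ μ ∈ youngDiagrams n n, Fintype.card (YoungIndex μ) ^ 2 = n.factorial := by
  induction n with
  | zero =>
    have h : youngDiagrams 0 0 = {⊥} := by
      ext μ
      rw [mem_youngDiagrams_self, Finset.mem_singleton]
      exact ⟨eq_bot_of_card_eq_zero, fun h => h ▸ card_bot⟩
    simp [h, card_youngIndex_bot]
  | succ n ih =>
    have h1 : ∀ μ ∈ youngDiagrams (n + 1) (n + 1), Fintype.card (YoungIndex μ) ^ 2 =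
        ∑ κ ∈ μ.lowerCovers, Fintype.card (YoungIndex μ) * Fintype.card (YoungIndex κ) := by
      intro μ hμ
      rw [mem_youngDiagrams_self] at hμ
      rw [← Finset.mul_sum, ← card_youngIndex_eq_sum, sq]
      rintro rfl
      rw [card_bot] at hμ
      omega
    have h2 : ∀ κ ∈ youngDiagrams n n,
        ∑ μ ∈ κ.upperCovers, Fintype.card (YoungIndex μ) * Fintype.card (YoungIndex κ) =
        (n + 1) * Fintype.card (YoungIndex κ) ^ 2 := by
      intro κ hκ
      rw [mem_youngDiagrams_self] at hκ
      rw [← Finset.sum_mul, sum_upperCovers_card_youngIndex n κ hκ]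
      ring
    rw [Finset.sum_congr rfl h1, Finset.sum_comm' (t' := youngDiagrams n n)
      (s' := fun κ => κ.upperCovers), Finset.sum_congr rfl h2, ← Finset.mul_sum, ih,
      Nat.factorial_succ]
    intro μ κ
    simp only [mem_youngDiagrams_self, mem_lowerCovers, mem_upperCovers]
    constructor
    · rintro ⟨h3, h4⟩
      have := card_eq_of_covBy h4
      exact ⟨h4, by omega⟩
    · rintro ⟨h4, h3⟩
      have := card_eq_of_covBy h4
      exact ⟨by omega, h4⟩

end YoungLattice

/-! ### Composition of paths and iterated restriction in PRIR form. -/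

section Paths

open YoungDiagram

namespace YoungPath

variable {α β μ : YoungDiagram}

/-- Each step adds one box, so a path passes through every intermediate size and can be cut there.
-/
theorem exists_eq_comp (q : YoungPath α μ) {M : ℕ} (h1 : α.card ≤ M) (h2 : M ≤ μ.card) :
    ∃ (β : YoungDiagram) (a : YoungPath α β) (r : YoungPath β μ), β.card = M ∧ q = a.comp r := by
  induction q with
  | nil => exact ⟨α, nil, nil, by omega, rfl⟩
  | @cons κ μ p h ih =>
    rcases Nat.lt_or_ge κ.card M with hlt | hle
    · have := card_eq_of_covBy h
      exact ⟨μ, cons p h, nil, by omega, rfl⟩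
    · obtain ⟨β, a, r, hβ, rfl⟩ := ih hle
      exact ⟨β, a, cons r h, hβ, rfl⟩

theorem comp_injective_left (r : YoungPath β μ) :
    Function.Injective fun a : YoungPath α β => a.comp r := by
  induction r with
  | nil => exact fun a b h => h
  | cons r h ih =>
    intro a b hab
    exact ih (by simpa [comp] using hab)

theorem comp_right_injective (a : YoungPath α β) :
    Function.Injective fun r : YoungPath β μ => a.comp r := by
  intro r
  induction r with
  | nil =>
    intro s hs
    cases s with
    | nil => rfl
    | cons s h =>
      have h1 := card_le_card_of_le s.le
      have h2 := card_eq_of_covBy h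
      omega
  | cons r h ih =>
    intro s hs
    cases s with
    | nil =>
      have h1 := card_le_card_of_le r.le
      have h2 := card_eq_of_covBy h
      omega
    | cons s h' =>
      simp only [comp] at hs
      injection hs with h1 _ h2
      subst h1
      have := ih (eq_of_heq h2)
      subst this
      rfl

end YoungPath

theorem viaEmbedding_castAddEmb_castAdd {n k : ℕ} (σ : Perm (Fin n)) (i : Fin n) :
    σ.viaEmbedding (Fin.castAddEmb k) (Fin.castAdd k i) = Fin.castAdd k (σ i) :=
  Perm.viaEmbedding_apply σ (Fin.castAddEmb k) i

theorem viaEmbedding_castAddEmb_natAdd {n k : ℕ} (σ : Perm (Fin n)) (j : Fin k) :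
    σ.viaEmbedding (Fin.castAddEmb k) (Fin.natAdd n j) = Fin.natAdd n j := by
  apply Perm.viaEmbedding_apply_of_notMem
  rintro ⟨i, hi⟩
  have := congrArg Fin.val hi
  simp at this
  omega

theorem viaEmbedding_castAddEmb_zero {n : ℕ} (σ : Perm (Fin n)) :
    σ.viaEmbedding (Fin.castAddEmb 0) = σ := by
  ext i
  exact congrArg Fin.val (viaEmbedding_castAddEmb_castAdd (k := 0) σ i)

theorem viaEmbedding_castAddEmb_succ {n k : ℕ} (σ : Perm (Fin n)) :
    σ.viaEmbedding (Fin.castAddEmb (k + 1)) =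
      (σ.viaEmbedding (Fin.castAddEmb k)).viaEmbedding (Fin.castSuccEmb : Fin (n + k) ↪ _) := by
  ext1 i
  refine Fin.addCases (fun i => ?_) (fun j => ?_) i
  · rw [viaEmbedding_castAddEmb_castAdd]
    have h := Perm.viaEmbedding_apply (σ.viaEmbedding (Fin.castAddEmb k))
      (Fin.castSuccEmb : Fin (n + k) ↪ _) (Fin.castAdd k i)
    rw [viaEmbedding_castAddEmb_castAdd] at h
    exact h.symm
  · rw [viaEmbedding_castAddEmb_natAdd]
    refine Fin.lastCases ?_ (fun j => ?_) j
    · symm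
      apply Perm.viaEmbedding_apply_of_notMem
      rintro ⟨i, hi⟩
      have := congrArg Fin.val hi
      simp at this
      omega
    · have h := Perm.viaEmbedding_apply (σ.viaEmbedding (Fin.castAddEmb k))
        (Fin.castSuccEmb : Fin (n + k) ↪ _) (Fin.natAdd n j)
      rw [viaEmbedding_castAddEmb_natAdd] at h
      exact h.symm

variable {N : ℕ} {φ : MatrixFamily}

/-- Together with `restrict_comp_ne` this makes the restriction of φ^μ to S(M) block diagonal, with
one copy of φ^α for each path `r` from `α` to `μ`. -/
theorem IsPRIR.restrict_comp (hφ : IsPRIR N φ) {M : ℕ} {α : YoungDiagram} (hα : α.card = M)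
    (σ : Perm (Fin M)) (a b : YoungIndex α) : ∀ (k : ℕ) {μ : YoungDiagram} (r : YoungPath α μ),
    M + k ≤ N → μ.card = M + k →
    (φ (M + k) μ (σ.viaEmbedding (Fin.castAddEmb k))).1 (a.comp r) (b.comp r) = (φ M α σ).1 a b
  | 0, μ, r, hN, hμ => by
    cases r with
    | nil => rw [viaEmbedding_castAddEmb_zero]; rfl
    | cons r h =>
      have h1 := card_le_card_of_le r.le
      have h2 := card_eq_of_covBy h
      omega
  | k + 1, μ, r, hN, hμ => by
    cases r with
    | nil => omega
    | cons r h =>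
      have h2 := card_eq_of_covBy h
      rw [viaEmbedding_castAddEmb_succ]
      exact (hφ.restrict_same (M + k) _ _ h hN hμ _ _ _).trans
        (hφ.restrict_comp hα σ a b k r (by omega) (by omega))

theorem IsPRIR.restrict_comp_ne (hφ : IsPRIR N φ) {M : ℕ} {α : YoungDiagram} (hα : α.card = M)
    (σ : Perm (Fin M)) (a : YoungIndex α) : ∀ (k : ℕ) {μ : YoungDiagram} (r : YoungPath α μ)
    (q : YoungIndex μ), (∀ c : YoungIndex α, c.comp r ≠ q) → M + k ≤ N → μ.card = M + k →
    (φ (M + k) μ (σ.viaEmbedding (Fin.castAddEmb k))).1 (a.comp r) q = 0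
  | 0, μ, r, q, hq, hN, hμ => by
    cases r with
    | nil => exact absurd rfl (hq q)
    | cons r h =>
      have h1 := card_le_card_of_le r.le
      have h2 := card_eq_of_covBy h
      omega
  | k + 1, μ, r, q, hq, hN, hμ => by
    cases r with
    | nil => omega
    | @cons κ _ r h =>
      have h2 := card_eq_of_covBy h
      rw [viaEmbedding_castAddEmb_succ]
      cases q with
      | nil => rw [card_bot] at hμ; omega
      | @cons κ' _ q h' =>
        rcases eq_or_ne κ κ' with rfl | hne
        · refine (hφ.restrict_same (M + k) _ _ h hN hμ _ _ _).trans
            (hφ.restrict_comp_ne hα σ a k r q ?_ (by omega) (by omega))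
          rintro c rfl
          exact hq c rfl
        · exact hφ.restrict_ne (M + k) _ _ _ h h' hne hN hμ _ _ _

end Paths

/-! ### Linear independence of the matrix units. -/

section MatrixAlgHom

variable {G ι κ : Type} [Group G] [Fintype G] [Fintype ι] [DecidableEq ι] [Fintype κ]
  [DecidableEq κ]

theorem matrixAlgHom_matrixUnit {ρ : G →* Matrix.unitaryGroup ι ℂ}
    (h : (matrixRep ρ).IsIrreducible) (i j : ι) :
    matrixAlgHom ρ (matrixUnit ρ i j) = Matrix.single i j 1 := by
  ext k l
  rw [matrixUnit_eq_sum, map_sum, Matrix.sum_apply]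
  simp only [map_smul, matrixAlgHom_single, Matrix.smul_apply, smul_eq_mul, mul_assoc]
  rw [← Finset.mul_sum]
  simp only [mul_comm ((ρ _⁻¹).1 j i)]
  rw [schur_orthogonality h, Matrix.single_apply]
  simp only [eq_comm]

theorem matrixAlgHom_matrixUnit_of_isEmpty {ρ : G →* Matrix.unitaryGroup ι ℂ}
    {ρ' : G →* Matrix.unitaryGroup κ ℂ}
    (h : (matrixRep ρ).IsIrreducible) (h' : (matrixRep ρ').IsIrreducible)
    (hne : IsEmpty (Representation.Equiv (matrixRep ρ') (matrixRep ρ))) (i j : κ) :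
    matrixAlgHom ρ (matrixUnit ρ' i j) = 0 := by
  ext k l
  rw [matrixUnit_eq_sum, map_sum, Matrix.sum_apply]
  simp only [map_smul, matrixAlgHom_single, Matrix.smul_apply, smul_eq_mul, mul_assoc]
  rw [← Finset.mul_sum]
  simp only [mul_comm ((ρ' _⁻¹).1 j i)]
  rw [schur_orthogonality_of_isEmpty h h' hne, mul_zero, Matrix.zero_apply]

/-- The representation `ρ a` sends its own matrix units to elementary matrices and kills the others,
so its entry (i, j) reads off a single coefficient. -/
theorem linearIndependent_matrixUnit {I : Type*} [Fintype I] {ι : I → Type} [∀ a, Fintype (ι a)]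
    [∀ a, DecidableEq (ι a)] {ρ : ∀ a, G →* Matrix.unitaryGroup (ι a) ℂ}
    (h : ∀ a, (matrixRep (ρ a)).IsIrreducible)
    (hne : ∀ a b, a ≠ b → IsEmpty (Representation.Equiv (matrixRep (ρ a)) (matrixRep (ρ b)))) :
    LinearIndependent ℂ fun x : Σ a, ι a × ι a => matrixUnit (ρ x.1) x.2.1 x.2.2 := by
  rw [Fintype.linearIndependent_iff]
  rintro c hc ⟨a, i, j⟩
  have h1 := congrFun (congrFun (congrArg (matrixAlgHom (ρ a)) hc) i) j
  simp only [map_sum, map_smul, Matrix.sum_apply, Matrix.smul_apply, map_zero,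
    Matrix.zero_apply] at h1
  rw [Fintype.sum_sigma, Finset.sum_eq_single a, Finset.sum_eq_single (i, j)] at h1
  · simpa [matrixAlgHom_matrixUnit (h a)] using h1
  · rintro ⟨i', j'⟩ - hij
    rw [matrixAlgHom_matrixUnit (h a), Matrix.single_apply_of_ne, smul_zero]
    intro hh
    exact hij (Prod.ext hh.1 hh.2)
  · simp
  · rintro b - hb
    refine Finset.sum_eq_zero fun x _ => ?_
    rw [matrixAlgHom_matrixUnit_of_isEmpty (h a) (h b) (hne b a hb), Matrix.zero_apply, smul_zero]
  · simp

end MatrixAlgHom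

/-! ### The matrix units span the group algebra. -/

section Completeness

variable {N : ℕ} {φ : MatrixFamily}

theorem IsPRIR.isIrreducible (hφ : IsPRIR N φ) {m : ℕ} (hm : m ≤ N) {μ : YoungDiagram}
    (hμ : μ.card = m) : (matrixRep (φ m μ)).IsIrreducible :=
  (hφ.irrep m μ hm hμ).1

theorem IsPRIR.isEmpty_equiv (hφ : IsPRIR N φ) {m : ℕ} (hm : m ≤ N) {μ ν : YoungDiagram}
    (hμ : μ.card = m) (hν : ν.card = m) (hne : μ ≠ ν) :
    IsEmpty (Representation.Equiv (matrixRep (φ m μ)) (matrixRep (φ m ν))) :=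
  (hφ.irrep m μ hm hμ).isEmpty_equiv (hφ.irrep m ν hm hν) hne

/-- The matrix units are independent, and there are ∑ d_μ² = m! of them, the dimension of the group
algebra. -/
theorem IsPRIR.span_matrixUnit (hφ : IsPRIR N φ) {m : ℕ} (hm : m ≤ N) :
    Submodule.span ℂ {x | ∃ μ ∈ youngDiagrams m m, ∃ i j, x = matrixUnit (φ m μ) i j} = ⊤ := by
  have hcard : ∀ μ : youngDiagrams m m, μ.1.card = m :=
    fun μ => YoungDiagram.mem_youngDiagrams_self.1 μ.2
  have hli := linearIndependent_matrixUnit (ρ := fun μ : youngDiagrams m m => φ m μ.1)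
    (fun μ => hφ.isIrreducible hm (hcard μ))
    (fun μ ν hne => hφ.isEmpty_equiv hm (hcard μ) (hcard ν) fun h => hne (Subtype.ext h))
  have hdim : Fintype.card (Σ μ : youngDiagrams m m, YoungIndex μ.1 × YoungIndex μ.1) =
      Module.finrank ℂ (MonoidAlgebra ℂ (Perm (Fin m))) := by
    rw [Fintype.card_sigma]
    simp only [Fintype.card_prod, ← sq]
    rw [Finset.sum_coe_sort (youngDiagrams m m) fun μ => Fintype.card (YoungIndex μ) ^ 2,
      sum_card_youngIndex_sq, (MonoidAlgebra.coeffLinearEquiv ℂ).finrank_eq]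
    simp [Fintype.card_perm]
  have hspan := hli.span_eq_top_of_card_eq_finrank' hdim
  rw [eq_top_iff, ← hspan, Submodule.span_le]
  rintro _ ⟨⟨μ, i, j⟩, rfl⟩
  exact Submodule.subset_span ⟨μ.1, μ.2, i, j, rfl⟩

end Completeness

/-! ### Permutation operators, extension by the identity and partial trace. -/

section TensorOp

variable {d : ℕ}

theorem Fin.sum_append {R : Type*} [AddCommMonoid R] {m n : ℕ} (f : (Fin (m + n) → Fin d) → R) :
    ∑ x, f x = ∑ a : Fin m → Fin d, ∑ b : Fin n → Fin d, f (Fin.append a b) := by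
  rw [← Fintype.sum_prod_type', ← (Fin.appendEquiv m n).sum_comp]
  rfl

theorem Fin.exists_eq_append {m n : ℕ} (x : Fin (m + n) → Fin d) :
    ∃ (a : Fin m → Fin d) (b : Fin n → Fin d), x = Fin.append a b :=
  ⟨_, _, (Fin.append_castAdd_natAdd (f := x)).symm⟩

theorem Fin.append_inj_iff {m n : ℕ} {a c : Fin m → Fin d} {b e : Fin n → Fin d} :
    Fin.append a b = Fin.append c e ↔ a = c ∧ b = e := by
  constructor
  · intro h
    constructor
    · ext1 i
      simpa using congrFun h (Fin.castAdd n i)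
    · ext1 i
      simpa using congrFun h (Fin.natAdd m i)
  · rintro ⟨rfl, rfl⟩
    rfl

theorem TensorOp.ext_append {m n : ℕ} {A B : TensorOp (m + n) d}
    (h : ∀ a b c e, A (Fin.append a b) (Fin.append c e) = B (Fin.append a b) (Fin.append c e)) :
    A = B := by
  ext x y
  obtain ⟨a, b, rfl⟩ := Fin.exists_eq_append x
  obtain ⟨c, e, rfl⟩ := Fin.exists_eq_append y
  exact h a b c e

theorem permOp_apply {n : ℕ} (σ : Perm (Fin n)) (y x : Fin n → Fin d) :
    permOp n d σ y x = if y = fun i => x (σ⁻¹ i) then 1 else 0 := rfl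

theorem mul_permOp_apply {n : ℕ} {ι : Type*} (A : Matrix ι (Fin n → Fin d) ℂ) (σ : Perm (Fin n))
    (x : ι) (y : Fin n → Fin d) : (A * permOp n d σ) x y = A x fun i => y (σ⁻¹ i) := by
  rw [Matrix.mul_apply, Finset.sum_eq_single fun i => y (σ⁻¹ i)]
  · simp [permOp_apply]
  · intro z _ hz
    rw [permOp_apply, if_neg hz, mul_zero]
  · simp

theorem permOp_mul {n : ℕ} (σ τ : Perm (Fin n)) :
    permOp n d (σ * τ) = permOp n d σ * permOp n d τ := by
  ext x y
  rw [mul_permOp_apply, permOp_apply, permOp_apply]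
  simp

theorem permOp_one {n : ℕ} : permOp n d 1 = 1 := by
  ext x y
  simp [permOp_apply, Matrix.one_apply]

theorem permOp_conjTranspose {n : ℕ} (σ : Perm (Fin n)) :
    (permOp n d σ).conjTranspose = permOp n d σ⁻¹ := by
  ext x y
  rw [Matrix.conjTranspose_apply, permOp_apply, permOp_apply]
  have h : (y = fun i => x (σ⁻¹ i)) ↔ (x = fun i => y (σ⁻¹⁻¹ i)) := by
    constructor
    · rintro rfl
      ext1 i
      simp
    · rintro h
      rw [h]
      ext1 i
      simp
  simp only [h]
  split_ifs <;> simp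

/-- The action of the group algebra of the symmetric group on the tensor power. -/
noncomputable def permAlgHom (n d : ℕ) : MonoidAlgebra ℂ (Perm (Fin n)) →ₐ[ℂ] TensorOp n d :=
  MonoidAlgebra.lift ℂ _ _ ⟨⟨permOp n d, permOp_one⟩, permOp_mul⟩

theorem permAlgHom_single {n : ℕ} (σ : Perm (Fin n)) :
    permAlgHom n d (MonoidAlgebra.single σ 1) = permOp n d σ := by
  simp [permAlgHom]

theorem permAlgHom_single' {n : ℕ} (σ : Perm (Fin n)) (c : ℂ) :
    permAlgHom n d (MonoidAlgebra.single σ c) = c • permOp n d σ := by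
  rw [← permAlgHom_single, ← map_smul, MonoidAlgebra.smul_single, smul_eq_mul, mul_one]

/-- The operator `A ⊗ 1` on `n + k` systems. -/
def extendOp (n k d : ℕ) : TensorOp n d →ₐ[ℂ] TensorOp (n + k) d :=
  AlgHom.ofLinearMap
    { toFun := fun A => Matrix.of fun x y => if (fun j => x (Fin.natAdd n j)) =
        (fun j => y (Fin.natAdd n j)) then A (fun i => x (Fin.castAdd k i))
          (fun i => y (Fin.castAdd k i)) else 0
      map_add' := by
        intro A B
        ext x y
        simp only [Matrix.of_apply, Matrix.add_apply]
        split_ifs <;> simp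
      map_smul' := by
        intro c A
        ext x y
        simp }
    (by
      apply TensorOp.ext_append
      intro a b c e
      simp only [LinearMap.coe_mk, AddHom.coe_mk, Matrix.of_apply, Matrix.one_apply, Fin.append_left,
        Fin.append_right, Fin.append_inj_iff]
      by_cases h1 : a = c <;> by_cases h2 : b = e <;> simp [h1, h2])
    (by
      intro A B
      apply TensorOp.ext_append
      intro a b c e
      simp only [LinearMap.coe_mk, AddHom.coe_mk, Matrix.of_apply, Matrix.mul_apply,
        Fin.append_left, Fin.append_right, Fin.sum_append, mul_ite, mul_zero, ite_mul, zero_mul]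
      by_cases h : b = e
      · subst h
        simp
      · rw [if_neg h]
        symm
        refine Finset.sum_eq_zero fun x _ => Finset.sum_eq_zero fun y _ => ?_
        split_ifs with h1 h2
        · exact absurd (h2.trans h1) h
        · rfl
        · rfl)

theorem extendOp_append {n k : ℕ} (A : TensorOp n d) (a c : Fin n → Fin d) (b e : Fin k → Fin d) :
    extendOp n k d A (Fin.append a b) (Fin.append c e) = if b = e then A a c else 0 := by
  simp [extendOp]

theorem extendOp_conjTranspose {n k : ℕ} (A : TensorOp n d) :
    extendOp n k d A.conjTranspose = (extendOp n k d A).conjTranspose := by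
  apply TensorOp.ext_append
  intro a b c e
  rw [Matrix.conjTranspose_apply, extendOp_append, extendOp_append, Matrix.conjTranspose_apply]
  by_cases h : b = e
  · simp [h]
  · simp [h, Ne.symm h]

theorem extendOp_permOp {n k : ℕ} (σ : Perm (Fin n)) :
    extendOp n k d (permOp n d σ) = permOp (n + k) d (σ.viaEmbedding (Fin.castAddEmb k)) := by
  apply TensorOp.ext_append
  intro a b c e
  rw [extendOp_append, permOp_apply, permOp_apply]
  have hinv : (σ.viaEmbedding (Fin.castAddEmb k))⁻¹ = σ⁻¹.viaEmbedding (Fin.castAddEmb k) :=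
    (map_inv (Perm.viaEmbeddingHom (Fin.castAddEmb k)) σ).symm
  have h : (fun i => Fin.append c e ((σ.viaEmbedding (Fin.castAddEmb k))⁻¹ i)) =
      Fin.append (fun i => c (σ⁻¹ i)) e := by
    ext1 i
    rw [hinv]
    refine Fin.addCases (fun i => ?_) (fun j => ?_) i
    · rw [viaEmbedding_castAddEmb_castAdd, Fin.append_left, Fin.append_left]
    · rw [viaEmbedding_castAddEmb_natAdd, Fin.append_right, Fin.append_right]
  rw [h]
  simp only [Fin.append_inj_iff]
  by_cases h1 : b = e <;> simp [h1]

/-- The partial trace over the last `k` systems. -/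
def partialTrace (n k d : ℕ) : TensorOp (n + k) d →ₗ[ℂ] TensorOp n d where
  toFun X := Matrix.of fun a c => ∑ e : Fin k → Fin d, X (Fin.append a e) (Fin.append c e)
  map_add' X Y := by
    ext a c
    simp [Finset.sum_add_distrib]
  map_smul' r X := by
    ext a c
    simp [Finset.mul_sum]

theorem partialTrace_apply {n k : ℕ} (X : TensorOp (n + k) d) (a c : Fin n → Fin d) :
    partialTrace n k d X a c = ∑ e : Fin k → Fin d, X (Fin.append a e) (Fin.append c e) := rfl

theorem partialTrace_extendOp_mul {n k : ℕ} (A : TensorOp n d) (X : TensorOp (n + k) d) :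
    partialTrace n k d (extendOp n k d A * X) = A * partialTrace n k d X := by
  ext a c
  simp only [partialTrace_apply, Matrix.mul_apply, Fin.sum_append, extendOp_append, ite_mul,
    zero_mul, Finset.sum_ite_eq, Finset.mem_univ, if_true, Finset.mul_sum]
  rw [Finset.sum_comm]

theorem partialTrace_mul_extendOp {n k : ℕ} (A : TensorOp n d) (X : TensorOp (n + k) d) :
    partialTrace n k d (X * extendOp n k d A) = partialTrace n k d X * A := by
  ext a c
  simp only [partialTrace_apply, Matrix.mul_apply, Fin.sum_append, extendOp_append, mul_ite,
    mul_zero, Finset.sum_ite_eq', Finset.mem_univ, if_true, Finset.sum_mul]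
  rw [Finset.sum_comm]

theorem trace_partialTrace {n k : ℕ} (X : TensorOp (n + k) d) :
    (partialTrace n k d X).trace = X.trace := by
  simp [Matrix.trace, partialTrace_apply, Fin.sum_append]

theorem partialTrace_zero {n : ℕ} (X : TensorOp (n + 0) d) : partialTrace n 0 d X = X := by
  ext a c
  rw [partialTrace_apply, Fintype.sum_unique, Fin.append_right_nil _ _ rfl,
    Fin.append_right_nil _ _ rfl]
  rfl

theorem partialTrace_succ {n k : ℕ} (X : TensorOp (n + (k + 1)) d) :
    partialTrace n (k + 1) d X = partialTrace n k d (partialTrace (n + k) 1 d X) := by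
  ext a c
  simp only [partialTrace_apply]
  rw [Fin.sum_append (m := k) (n := 1)]
  refine Finset.sum_congr rfl fun e _ => Finset.sum_congr rfl fun f _ => ?_
  rw [Fin.append_assoc, Fin.append_assoc]
  rfl

theorem exists_eq_viaEmbedding_castAddEmb_one {n : ℕ} (σ : Perm (Fin (n + 1)))
    (h : σ (Fin.last n) = Fin.last n) :
    ∃ τ : Perm (Fin n), σ = τ.viaEmbedding (Fin.castAddEmb 1) := by
  have h1 : ∀ i : Fin n, ∃ j : Fin n, Fin.castSucc j = σ (Fin.castSucc i) := by
    intro i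
    apply Fin.exists_castSucc_eq.2
    intro h2
    exact (Fin.castSucc_lt_last i).ne (σ.injective (h2.trans h.symm))
  choose g hg using h1
  have hinj : Function.Injective g := by
    intro i j hij
    apply Fin.castSucc_injective
    apply σ.injective
    rw [← hg, ← hg, hij]
  refine ⟨Equiv.ofBijective g (Finite.injective_iff_bijective.1 hinj), ?_⟩
  ext1 i
  refine Fin.addCases (fun i => ?_) (fun j => ?_) i
  · rw [viaEmbedding_castAddEmb_castAdd]
    exact (hg i).symm
  · rw [viaEmbedding_castAddEmb_natAdd]
    have : Fin.natAdd n j = Fin.last n := by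
      ext
      simp
    rw [this, h]

theorem partialTrace_one_swap {n : ℕ} (j : Fin n) :
    partialTrace n 1 d (permOp (n + 1) d (swap (Fin.castAdd 1 j) (Fin.natAdd n 0))) = 1 := by
  ext a c
  have h : ∀ e : Fin 1 → Fin d, (Fin.append a e = fun i =>
      Fin.append c e ((swap (Fin.castAdd 1 j) (Fin.natAdd n 0))⁻¹ i)) ↔ (e = fun _ => c j) ∧ a = c := by
    intro e
    have hlast : ∀ i : Fin n, Fin.castAdd 1 i ≠ Fin.natAdd n 0 := by
      intro i hi
      have := congrArg Fin.val hi
      simp at this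
      omega
    rw [swap_inv]
    constructor
    · intro h
      have h1 := congrFun h (Fin.natAdd n 0)
      rw [swap_apply_right, Fin.append_right, Fin.append_left] at h1
      refine ⟨?_, ?_⟩
      · ext1 i
        rw [Subsingleton.elim i 0, h1]
      · ext1 i
        have h2 := congrFun h (Fin.castAdd 1 i)
        rw [Fin.append_left] at h2
        rw [h2]
        rcases eq_or_ne i j with rfl | hij
        · rw [swap_apply_left, Fin.append_right, h1]
        · rw [swap_apply_of_ne_of_ne _ (hlast i), Fin.append_left]
          intro h3
          exact hij (Fin.castAdd_injective n 1 h3)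
    · rintro ⟨rfl, rfl⟩
      ext1 i
      refine Fin.addCases (fun i => ?_) (fun i => ?_) i
      · rcases eq_or_ne i j with rfl | hij
        · rw [swap_apply_left, Fin.append_right, Fin.append_left]
        · rw [swap_apply_of_ne_of_ne _ (hlast i)]
          intro h3
          exact hij (Fin.castAdd_injective n 1 h3)
      · rw [Subsingleton.elim i 0, swap_apply_right, Fin.append_right, Fin.append_left]
  simp only [partialTrace_apply, permOp_apply, h, Matrix.one_apply]
  by_cases hac : a = c <;> simp [hac]

theorem partialTrace_one_one {n : ℕ} : partialTrace n 1 d 1 = (d : ℂ) • 1 := by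
  ext a c
  simp only [partialTrace_apply, Matrix.one_apply, Fin.append_inj_iff, and_true, Matrix.smul_apply]
  split_ifs <;> simp

theorem permOp_mem_range {n : ℕ} (σ : Perm (Fin n)) : permOp n d σ ∈ (permAlgHom n d).range :=
  ⟨MonoidAlgebra.single σ 1, permAlgHom_single σ⟩

theorem permAlgHom_range_induction {n : ℕ} (S : Submodule ℂ (TensorOp n d))
    (h : ∀ σ, permOp n d σ ∈ S) {X : TensorOp n d} (hX : X ∈ (permAlgHom n d).range) : X ∈ S := by
  obtain ⟨x, rfl⟩ := hX
  change permAlgHom n d x ∈ S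
  induction x using MonoidAlgebra.induction_on with
  | of σ => simpa [permAlgHom_single] using h σ
  | add x y hx hy => rw [map_add]; exact S.add_mem hx hy
  | smul c x hx => rw [map_smul]; exact S.smul_mem c hx

/-- A permutation fixing the last system is traced to a permutation operator times `d`. Any other is
a transposition moving the last system times one that fixes it, and the partial trace of that
transposition is the identity. -/
theorem partialTrace_one_mem_range {n : ℕ} {X : TensorOp (n + 1) d}
    (hX : X ∈ (permAlgHom (n + 1) d).range) :
    partialTrace n 1 d X ∈ (permAlgHom n d).range := by
  refine permAlgHom_range_induction
    ((Subalgebra.toSubmodule (permAlgHom n d).range).comap (partialTrace n 1 d)) (fun σ => ?_) hX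
  rw [Submodule.mem_comap, Subalgebra.mem_toSubmodule]
  have hfix : ∀ σ : Perm (Fin (n + 1)), σ (Fin.last n) = Fin.last n →
      ∃ τ, permOp (n + 1) d σ = extendOp n 1 d (permOp n d τ) := by
    intro σ hσ
    obtain ⟨τ, rfl⟩ := exists_eq_viaEmbedding_castAddEmb_one σ hσ
    exact ⟨τ, (extendOp_permOp τ).symm⟩
  induction hj : σ (Fin.last n) using Fin.lastCases with
  | last =>
    obtain ⟨τ, hτ⟩ := hfix σ hj
    rw [hτ, ← mul_one (extendOp n 1 d _), partialTrace_extendOp_mul, partialTrace_one_one,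
      mul_smul_comm, mul_one]
    exact Subalgebra.smul_mem _ (permOp_mem_range τ) _
  | cast j =>
    obtain ⟨τ, hτ⟩ := hfix (swap j.castSucc (Fin.last n) * σ)
      (by rw [Perm.mul_apply, hj, swap_apply_left])
    have h1 : permOp (n + 1) d σ = permOp (n + 1) d (swap j.castSucc (Fin.last n)) *
        extendOp n 1 d (permOp n d τ) := by
      rw [← hτ, ← permOp_mul, ← mul_assoc, swap_mul_self, one_mul]
    have h2 : partialTrace n 1 d (permOp (n + 1) d (swap j.castSucc (Fin.last n))) = 1 :=
      partialTrace_one_swap j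
    rw [h1, partialTrace_mul_extendOp, h2, one_mul]
    exact permOp_mem_range τ

theorem partialTrace_mem_range {n : ℕ} : ∀ {k : ℕ} {X : TensorOp (n + k) d},
    X ∈ (permAlgHom (n + k) d).range → partialTrace n k d X ∈ (permAlgHom n d).range
  | 0, X, hX => by rw [partialTrace_zero]; exact hX
  | k + 1, X, hX => by
    rw [partialTrace_succ]
    exact partialTrace_mem_range (partialTrace_one_mem_range hX)

end TensorOp

/-! ### Maximally entangled pairs, partial transposition and the operator V^(k). -/

section Contraction

variable {d : ℕ}

/-- The matrix with entries `0` and `1` that tensors a vector on `M` systems with `k` unnormalized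
maximally entangled pairs; the pairs consist of the systems `M + j` and `M + 2 k - 1 - j`. -/
def pairInsertion (M k d : ℕ) : Matrix (Fin (M + k + k) → Fin d) (Fin M → Fin d) ℂ :=
  Matrix.of fun x z => if (fun i => x (Fin.castAdd k i)) =
    Fin.append z (fun j => x (Fin.natAdd (M + k) (Fin.rev j))) then 1 else 0

theorem pairInsertion_append {M k : ℕ} (a : Fin (M + k) → Fin d) (b : Fin k → Fin d)
    (z : Fin M → Fin d) :
    pairInsertion M k d (Fin.append a b) z =
      if a = Fin.append z (fun j => b (Fin.rev j)) then 1 else 0 := by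
  simp [pairInsertion]

theorem mul_pairInsertion_apply {M k : ℕ} {ι : Type*}
    (A : Matrix ι (Fin (M + k + k) → Fin d) ℂ) (x : ι) (z : Fin M → Fin d) :
    (A * pairInsertion M k d) x z =
      ∑ b : Fin k → Fin d, A x (Fin.append (Fin.append z fun j => b (Fin.rev j)) b) := by
  rw [Matrix.mul_apply, Fin.sum_append, Finset.sum_comm]
  simp [pairInsertion_append]

theorem pairInsertion_conjTranspose_mul_apply {M k : ℕ} {ι : Type*}
    (A : Matrix (Fin (M + k + k) → Fin d) ι ℂ) (z : Fin M → Fin d) (x : ι) :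
    ((pairInsertion M k d).conjTranspose * A) z x =
      ∑ b : Fin k → Fin d, A (Fin.append (Fin.append z fun j => b (Fin.rev j)) b) x := by
  rw [Matrix.mul_apply, Fin.sum_append, Finset.sum_comm]
  refine Finset.sum_congr rfl fun b _ => ?_
  rw [Finset.sum_eq_single (Fin.append z fun j => b (Fin.rev j))]
  · simp [pairInsertion_append]
  · intro a _ ha
    simp [pairInsertion_append, ha]
  · simp

/-- Both sides sum over equal labels on the k traced systems; the order reversal within the pairs
only permutes the summation index. -/
theorem pairInsertion_conjTranspose_mul_extendOp_mul {M k : ℕ} (X : TensorOp (M + k) d) :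
    (pairInsertion M k d).conjTranspose * extendOp (M + k) k d X * pairInsertion M k d =
      partialTrace M k d X := by
  ext z w
  rw [mul_pairInsertion_apply]
  simp only [pairInsertion_conjTranspose_mul_apply, extendOp_append]
  rw [Finset.sum_comm]
  simp only [Finset.sum_ite_eq, Finset.mem_univ, if_true, partialTrace_apply]
  exact (Equiv.arrowCongr Fin.revPerm (Equiv.refl (Fin d))).sum_comp
    (fun e => X (Fin.append z e) (Fin.append w e))

/-- The first M systems take no part in the inserted pairs, so `Y` may act before or after the
insertion. -/
theorem extendOp_extendOp_mul_pairInsertion {M k : ℕ} (Y : TensorOp M d) :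
    extendOp (M + k) k d (extendOp M k d Y) * pairInsertion M k d = pairInsertion M k d * Y := by
  ext x z
  obtain ⟨a, b, rfl⟩ := Fin.exists_eq_append x
  obtain ⟨u, f, rfl⟩ := Fin.exists_eq_append a
  rw [mul_pairInsertion_apply, Matrix.mul_apply]
  simp only [extendOp_append, pairInsertion_append, Fin.append_inj_iff, Finset.sum_ite_eq,
    Finset.mem_univ, if_true]
  by_cases h : f = fun j => b (Fin.rev j) <;> simp [h]

/-! ### Partial transposition -/

theorem partialTranspose_append {n k : ℕ} (A : TensorOp (n + k) d) (j : Fin k)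
    (a c : Fin n → Fin d) (b e : Fin k → Fin d) :
    partialTranspose (Fin.natAdd n j) A (Fin.append a b) (Fin.append c e) =
      A (Fin.append a (Function.update b j (e j))) (Fin.append c (Function.update e j (b j))) := by
  have h : ∀ (a : Fin n → Fin d) (b : Fin k → Fin d) (v : Fin d),
      Function.update (Fin.append a b) (Fin.natAdd n j) v = Fin.append a (Function.update b j v) := by
    intro a b v
    ext1 i
    refine Fin.addCases (fun i => ?_) (fun i => ?_) i
    · rw [Function.update_of_ne, Fin.append_left, Fin.append_left]
      intro hi
      have := congrArg Fin.val hi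
      simp at this
      omega
    · rw [Fin.append_right]
      rcases eq_or_ne i j with rfl | hij
      · simp
      · rw [Function.update_of_ne hij, Function.update_of_ne, Fin.append_right]
        intro hi
        exact hij (Fin.natAdd_injective k n hi)
  simp only [partialTranspose, Matrix.of_apply, Fin.append_right, h]

theorem foldr_partialTranspose_append {n k : ℕ} (A : TensorOp (n + k) d) (a c : Fin n → Fin d) :
    ∀ (l : List (Fin k)) (_ : l.Nodup) (b e : Fin k → Fin d),
    l.foldr (fun j B => partialTranspose (Fin.natAdd n j) B) A (Fin.append a b) (Fin.append c e) =
      A (Fin.append a fun j => if j ∈ l then e j else b j)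
        (Fin.append c fun j => if j ∈ l then b j else e j)
  | [], _, b, e => by simp
  | j :: l, hl, b, e => by
    rw [List.foldr_cons, partialTranspose_append,
      foldr_partialTranspose_append A a c l (List.nodup_cons.1 hl).2]
    have hj := (List.nodup_cons.1 hl).1
    congr 2
    · ext1 i
      rcases eq_or_ne i j with rfl | hij
      · simp [hj]
      · simp [hij]
    · ext1 i
      rcases eq_or_ne i j with rfl | hij
      · simp [hj]
      · simp [hij]

theorem partialTransposeLast_append {n k : ℕ} (A : TensorOp (n + k) d) (a c : Fin n → Fin d)
    (b e : Fin k → Fin d) :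
    partialTransposeLast n k A (Fin.append a b) (Fin.append c e) =
      A (Fin.append a e) (Fin.append c b) := by
  simp [partialTransposeLast, foldr_partialTranspose_append A a c _ (List.nodup_finRange k)]

theorem partialTransposeLast_conjTranspose {n k : ℕ} (A : TensorOp (n + k) d) :
    (partialTransposeLast n k A).conjTranspose = partialTransposeLast n k A.conjTranspose := by
  apply TensorOp.ext_append
  intro a b c e
  rw [Matrix.conjTranspose_apply, partialTransposeLast_append, partialTransposeLast_append,
    Matrix.conjTranspose_apply]

theorem partialTransposeLast_mul_extendOp {n k : ℕ} (A : TensorOp (n + k) d) (X : TensorOp n d) :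
    partialTransposeLast n k (A * extendOp n k d X) =
      partialTransposeLast n k A * extendOp n k d X := by
  apply TensorOp.ext_append
  intro a b c e
  simp only [partialTransposeLast_append, Matrix.mul_apply, Fin.sum_append, extendOp_append,
    mul_ite, mul_zero, Finset.sum_ite_eq', Finset.mem_univ, if_true]

theorem partialTransposeLast_extendOp {n k : ℕ} (X : TensorOp n d) :
    partialTransposeLast n k (extendOp n k d X) = extendOp n k d X := by
  apply TensorOp.ext_append
  intro a b c e
  simp only [partialTransposeLast_append, extendOp_append, eq_comm]

/-- The permutation exchanging the two systems of each of the `k` pairs. -/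
def pairSwap (M k : ℕ) : Perm (Fin (M + k + k)) :=
  Function.Involutive.toPerm
    (Fin.addCases (Fin.addCases (fun i => Fin.castAdd k (Fin.castAdd k i))
      fun j => Fin.natAdd (M + k) (Fin.rev j)) fun j => Fin.castAdd k (Fin.natAdd M (Fin.rev j)))
    (by
      intro i
      refine Fin.addCases (fun i => Fin.addCases (fun i => ?_) (fun j => ?_) i) (fun j => ?_) i <;>
        simp)

theorem pairSwap_apply {M k : ℕ} (i : Fin (M + k + k)) : pairSwap M k i =
    Fin.addCases (Fin.addCases (fun i => Fin.castAdd k (Fin.castAdd k i))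
      fun j => Fin.natAdd (M + k) (Fin.rev j)) (fun j => Fin.castAdd k (Fin.natAdd M (Fin.rev j))) i :=
  rfl

theorem append_comp_pairSwap {M k : ℕ} (z : Fin M → Fin d) (b e : Fin k → Fin d) :
    (fun i => Fin.append (Fin.append z fun j => b (Fin.rev j)) e ((pairSwap M k)⁻¹ i)) =
      Fin.append (Fin.append z fun j => e (Fin.rev j)) b := by
  have h : (pairSwap M k)⁻¹ = pairSwap M k := Function.Involutive.toPerm_symm _
  ext1 i
  rw [h]
  refine Fin.addCases (fun i => Fin.addCases (fun i => ?_) (fun j => ?_) i) (fun j => ?_) i <;>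
    simp [pairSwap_apply]

/-- Against maximally entangled pairs, the transposed indices of `A` can be relabelled by the
partner systems, so that the partially transposed operator is replaced by one acting on the first M
+ k systems alone. -/
theorem partialTransposeLast_mul_pairInsertion {M k : ℕ} (A : TensorOp (M + k + k) d) :
    partialTransposeLast (M + k) k A * pairInsertion M k d =
      extendOp (M + k) k d (partialTrace (M + k) k d (A * permOp _ d (pairSwap M k))) *
        pairInsertion M k d := by
  ext x z
  obtain ⟨a, b, rfl⟩ := Fin.exists_eq_append x
  rw [mul_pairInsertion_apply, mul_pairInsertion_apply]
  simp only [partialTransposeLast_append, extendOp_append, Finset.sum_ite_eq, Finset.mem_univ,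
    if_true, partialTrace_apply, mul_permOp_apply, append_comp_pairSwap]

/-! ### The operator `V^(k)` -/

theorem partialTranspose_swap_apply {n : ℕ} {r s : Fin n} (hrs : r ≠ s) (x y : Fin n → Fin d) :
    partialTranspose s (permOp n d (swap r s)) x y =
      if x r = x s ∧ y r = y s ∧ ∀ i, i ≠ r → i ≠ s → x i = y i then 1 else 0 := by
  simp only [partialTranspose, Matrix.of_apply, permOp_apply, swap_inv]
  congr 1
  apply propext
  constructor
  · intro h
    refine ⟨?_, ?_, fun i hr hs => ?_⟩
    · have := congrFun h r
      rw [swap_apply_left, Function.update_of_ne hrs, Function.update_self] at this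
      exact this
    · have := congrFun h s
      rw [swap_apply_right, Function.update_of_ne hrs, Function.update_self] at this
      exact this.symm
    · have := congrFun h i
      rw [swap_apply_of_ne_of_ne hr hs, Function.update_of_ne hs, Function.update_of_ne hs] at this
      exact this
  · rintro ⟨h1, h2, h3⟩
    ext1 i
    rcases eq_or_ne i r with rfl | hr
    · rw [swap_apply_left, Function.update_of_ne hrs, Function.update_self, h1]
    rcases eq_or_ne i s with rfl | hs
    · rw [swap_apply_right, Function.update_of_ne hrs, Function.update_self, h2]
    rw [swap_apply_of_ne_of_ne hr hs, Function.update_of_ne hs, Function.update_of_ne hs, h3 i hr hs]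

theorem prod_ofFn_partialTranspose_swap_apply {n : ℕ} : ∀ {m : ℕ} (r s : Fin m → Fin n)
    (_ : Function.Injective r) (_ : Function.Injective s) (_ : ∀ i j, r i ≠ s j)
    (x y : Fin n → Fin d),
    (List.ofFn fun j => partialTranspose (s j) (permOp n d (swap (r j) (s j)))).prod x y =
      if (∀ j, x (r j) = x (s j)) ∧ (∀ j, y (r j) = y (s j)) ∧
        ∀ i, (∀ j, i ≠ r j ∧ i ≠ s j) → x i = y i then 1 else 0
  | 0, r, s, _, _, _, x, y => by
    simp [Matrix.one_apply, funext_iff]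
  | m + 1, r, s, hr, hs, hrs, x, y => by
    have hcs : ∀ i : Fin m, i.castSucc ≠ Fin.last m := fun i => (Fin.castSucc_lt_last i).ne
    rw [List.ofFn_succ', List.concat_eq_append, List.prod_append, List.prod_singleton,
      Matrix.mul_apply]
    simp only [prod_ofFn_partialTranspose_swap_apply (fun i : Fin m => r i.castSucc)
      (fun i => s i.castSucc) (hr.comp (Fin.castSucc_injective m))
      (hs.comp (Fin.castSucc_injective m)) (fun i j => hrs _ _),
      partialTranspose_swap_apply (hrs (Fin.last m) (Fin.last m))]
    simp only [← ite_and, mul_ite, mul_one, mul_zero]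
    -- The only intermediate index that can contribute: the first `m` factors fix `x` on the last
    -- pair, and the last factor fixes `y` off it.
    set z : Fin n → Fin d := fun i => if i = r (Fin.last m) ∨ i = s (Fin.last m) then x i else y i
      with hz
    have hzr : z (r (Fin.last m)) = x (r (Fin.last m)) := if_pos (Or.inl rfl)
    have hzs : z (s (Fin.last m)) = x (s (Fin.last m)) := if_pos (Or.inr rfl)
    have hzn : ∀ i, i ≠ r (Fin.last m) → i ≠ s (Fin.last m) → z i = y i :=
      fun i h1 h2 => if_neg (not_or.2 ⟨h1, h2⟩)
    have hzr' : ∀ j : Fin m, z (r j.castSucc) = y (r j.castSucc) :=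
      fun j => hzn _ (fun h => hcs j (hr h)) (hrs _ _)
    have hzs' : ∀ j : Fin m, z (s j.castSucc) = y (s j.castSucc) :=
      fun j => hzn _ (hrs _ _).symm (fun h => hcs j (hs h))
    rw [Finset.sum_eq_single z]
    · congr 1
      apply propext
      constructor
      · rintro ⟨⟨h4, h5, -⟩, h1, h2, h3⟩
        refine ⟨fun j => ?_, fun j => ?_, fun i hi => ?_⟩
        · refine Fin.lastCases ?_ (fun j => h1 j) j
          rw [← hzr, ← hzs, h4]
        · refine Fin.lastCases h5 (fun j => ?_) j
          rw [← hzr', ← hzs', h2]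
        · rw [h3 i fun j => hi j.castSucc, hzn i (hi _).1 (hi _).2]
      · rintro ⟨h1, h2, h3⟩
        refine ⟨⟨?_, h2 _, hzn⟩, fun j => h1 _, fun j => ?_, fun i hi => ?_⟩
        · rw [hzr, hzs, h1]
        · rw [hzr', hzs', h2]
        · by_cases hi' : i = r (Fin.last m) ∨ i = s (Fin.last m)
          · exact (if_pos hi').symm
          · rw [not_or] at hi'
            rw [hzn i hi'.1 hi'.2]
            exact h3 i (Fin.lastCases hi' hi)
    · intro w _ hw
      rw [if_neg]
      rintro ⟨⟨-, -, h6⟩, -, -, h3⟩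
      apply hw
      ext1 i
      by_cases hi' : i = r (Fin.last m) ∨ i = s (Fin.last m)
      · refine Eq.trans (h3 i fun j => ?_).symm (if_pos hi').symm
        rcases hi' with rfl | rfl
        · exact ⟨fun h => hcs j (hr h).symm, hrs _ _⟩
        · exact ⟨(hrs _ _).symm, fun h => hcs j (hs h).symm⟩
      · rw [not_or] at hi'
        rw [hzn i hi'.1 hi'.2, h6 i hi'.1 hi'.2]
    · simp

theorem contractionOp_eq (M k d : ℕ) :
    contractionOp (M + k) k d = pairInsertion M k d * (pairInsertion M k d).conjTranspose := by
  have h1 : contractionOp (M + k) k d = (List.ofFn fun j : Fin k =>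
      partialTranspose (Fin.natAdd (M + k) (Fin.rev j)) (permOp (M + k + k) d
        (swap (Fin.castAdd k (Fin.natAdd M j)) (Fin.natAdd (M + k) (Fin.rev j))))).prod := by
    unfold contractionOp
    congr 2
    ext1 j
    have hr : (⟨M + k - k + j, by omega⟩ : Fin (M + k + k)) = Fin.castAdd k (Fin.natAdd M j) := by
      ext
      simp
    have hs : (⟨M + k + k - 1 - j, by omega⟩ : Fin (M + k + k)) =
        Fin.natAdd (M + k) (Fin.rev j) := by
      ext
      simp only [Fin.val_natAdd, Fin.val_rev]
      omega
    rw [hr, hs]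
  rw [h1]
  ext x y
  rw [prod_ofFn_partialTranspose_swap_apply]
  rotate_left
  · exact (Fin.castAdd_injective _ _).comp (Fin.natAdd_injective _ _)
  · exact (Fin.natAdd_injective _ _).comp Fin.rev_injective
  · intro i j h
    have := congrArg Fin.val h
    simp at this
    omega
  obtain ⟨a, b, rfl⟩ := Fin.exists_eq_append x
  obtain ⟨u, f, rfl⟩ := Fin.exists_eq_append a
  obtain ⟨c, e, rfl⟩ := Fin.exists_eq_append y
  obtain ⟨v, g, rfl⟩ := Fin.exists_eq_append c
  rw [Matrix.mul_apply]
  simp only [Matrix.conjTranspose_apply, pairInsertion_append, Fin.append_inj_iff, Fin.append_left,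
    Fin.append_right]
  have h2 : (∀ i, (∀ j : Fin k, i ≠ Fin.castAdd k (Fin.natAdd M j) ∧
      i ≠ Fin.natAdd (M + k) (Fin.rev j)) →
      Fin.append (Fin.append u f) b i = Fin.append (Fin.append v g) e i) ↔ u = v := by
    constructor
    · intro h
      ext1 i
      have := h (Fin.castAdd k (Fin.castAdd k i)) fun j => ⟨fun h => ?_, fun h => ?_⟩
      · simpa using this
      all_goals
        have := congrArg Fin.val h
        simp at this
        omega
    · rintro rfl i hi
      induction i using Fin.addCases with
      | left i =>
        induction i using Fin.addCases with
        | left i => simp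
        | right j => exact absurd rfl (hi j).1
      | right j => exact absurd (by rw [Fin.rev_rev]) (hi (Fin.rev j)).2
  have h6 : (∀ j, f j = b (Fin.rev j)) ↔ f = fun j => b (Fin.rev j) := funext_iff.symm
  have h7 : (∀ j, g j = e (Fin.rev j)) ↔ g = fun j => e (Fin.rev j) := funext_iff.symm
  simp only [h2, h6, h7]
  by_cases h3 : f = fun j => b (Fin.rev j) <;> by_cases h4 : g = fun j => e (Fin.rev j) <;>
    by_cases h5 : u = v <;> simp [h3, h4, h5]

theorem extendOp_permOp_mem {N k : ℕ} {X : TensorOp N d} (hX : X ∈ (permAlgHom N d).range) :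
    extendOp N k d X ∈ partiallyTransposedAlgebra N k d := by
  refine permAlgHom_range_induction ((Subalgebra.toSubmodule
    (partiallyTransposedAlgebra N k d)).comap (extendOp N k d).toLinearMap) (fun σ => ?_) hX
  change extendOp N k d (permOp N d σ) ∈ partiallyTransposedAlgebra N k d
  apply Algebra.subset_adjoin
  refine ⟨σ.viaEmbedding (Fin.castAddEmb k), ?_⟩
  dsimp only
  rw [← extendOp_permOp, partialTransposeLast_extendOp]

theorem conjTranspose_mem_partiallyTransposedAlgebra {N k : ℕ} {a : TensorOp (N + k) d}
    (ha : a ∈ partiallyTransposedAlgebra N k d) :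
    a.conjTranspose ∈ partiallyTransposedAlgebra N k d := by
  induction ha using Algebra.adjoin_induction with
  | mem x hx =>
    obtain ⟨σ, rfl⟩ := hx
    dsimp only
    rw [partialTransposeLast_conjTranspose, permOp_conjTranspose]
    exact Algebra.subset_adjoin ⟨_, rfl⟩
  | algebraMap r =>
    rw [Algebra.algebraMap_eq_smul_one, Matrix.conjTranspose_smul, Matrix.conjTranspose_one]
    exact Subalgebra.smul_mem _ (Subalgebra.one_mem _) _
  | add x y _ _ hx hy => rw [Matrix.conjTranspose_add]; exact Subalgebra.add_mem _ hx hy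
  | mul x y _ _ hx hy => rw [Matrix.conjTranspose_mul]; exact Subalgebra.mul_mem _ hy hx

/-- For a generator, the replacement operator is a partial trace of permutation operators, hence
again a combination of permutation operators. Products follow because `Y` is arbitrary. -/
theorem exists_mul_extendOp_mul_pairInsertion {M k : ℕ} {a : TensorOp (M + k + k) d}
    (ha : a ∈ partiallyTransposedAlgebra (M + k) k d) :
    ∀ Y ∈ (permAlgHom (M + k) d).range, ∃ X ∈ (permAlgHom (M + k) d).range,
      a * (extendOp (M + k) k d Y * pairInsertion M k d) =
        extendOp (M + k) k d X * pairInsertion M k d := by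
  induction ha using Algebra.adjoin_induction with
  | mem x hx =>
    obtain ⟨σ, rfl⟩ := hx
    intro Y hY
    refine ⟨partialTrace (M + k) k d (permOp _ d σ * extendOp (M + k) k d Y *
      permOp _ d (pairSwap M k)), ?_, ?_⟩
    rotate_left
    · dsimp only
      rw [← Matrix.mul_assoc, ← partialTransposeLast_mul_extendOp,
        partialTransposeLast_mul_pairInsertion]
    · apply partialTrace_mem_range
      refine Subalgebra.mul_mem _ (Subalgebra.mul_mem _ (permOp_mem_range σ) ?_)
        (permOp_mem_range _)
      refine permAlgHom_range_induction ((Subalgebra.toSubmodule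
        (permAlgHom (M + k + k) d).range).comap (extendOp (M + k) k d).toLinearMap)
        (fun σ => ?_) hY
      change extendOp (M + k) k d (permOp (M + k) d σ) ∈ (permAlgHom (M + k + k) d).range
      rw [extendOp_permOp]
      exact permOp_mem_range _
  | algebraMap r =>
    intro Y hY
    refine ⟨r • Y, Subalgebra.smul_mem _ hY r, ?_⟩
    rw [Algebra.algebraMap_eq_smul_one, Matrix.smul_mul, Matrix.one_mul, map_smul, Matrix.smul_mul]
  | add x y _ _ hx hy =>
    intro Y hY
    obtain ⟨X, hX, hX'⟩ := hx Y hY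
    obtain ⟨Z, hZ, hZ'⟩ := hy Y hY
    exact ⟨X + Z, Subalgebra.add_mem _ hX hZ, by rw [Matrix.add_mul, hX', hZ', map_add, Matrix.add_mul]⟩
  | mul x y _ _ hx hy =>
    intro Y hY
    obtain ⟨Z, hZ, hZ'⟩ := hy Y hY
    obtain ⟨X, hX, hX'⟩ := hx Z hZ
    exact ⟨X, hX, by rw [Matrix.mul_assoc, hZ', hX']⟩

end Contraction

theorem Matrix.single_one_mulVec_single_one {m n : Type*} [DecidableEq m] [Fintype n]
    [DecidableEq n] (j : m) (i : n) :
    (Matrix.single j i (1 : ℂ)).mulVec (Pi.single i 1) = Pi.single j 1 := by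
  ext k
  rw [Matrix.mulVec_single_one, Matrix.col_apply, Matrix.single_apply, Pi.single_apply]
  simp [eq_comm]

/-! ### Matrix units on the tensor power: traces, vanishing and partial traces. -/

section TensorUnit

variable {N d : ℕ} {φ : MatrixFamily}

/-- The operator on `m` systems by which the matrix unit `(i, j)` of the irrep `μ` acts. -/
noncomputable def tensorUnit (φ : MatrixFamily) (m d : ℕ) (μ : YoungDiagram) (i j : YoungIndex μ) :
    TensorOp m d :=
  permAlgHom m d (matrixUnit (φ m μ) i j)

theorem opE_eq_extendOp (φ : MatrixFamily) (N k d : ℕ) (μ : YoungDiagram) (i j : YoungIndex μ) :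
    opE φ N k d μ i j = extendOp N k d (tensorUnit φ N d μ i j) := by
  simp only [opE, tensorUnit, matrixUnit, map_smul, map_sum, permAlgHom_single', extendOp_permOp,
    Fintype.card_perm, Fintype.card_fin]

theorem tensorUnit_mem_range (m : ℕ) (μ : YoungDiagram) (i j : YoungIndex μ) :
    tensorUnit φ m d μ i j ∈ (permAlgHom m d).range :=
  ⟨_, rfl⟩

theorem tensorUnit_conjTranspose (m : ℕ) (μ : YoungDiagram) (i j : YoungIndex μ) :
    (tensorUnit φ m d μ i j).conjTranspose = tensorUnit φ m d μ j i := by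
  simp only [tensorUnit, matrixUnit, map_smul, map_sum, permAlgHom_single', Matrix.conjTranspose_smul,
    Matrix.conjTranspose_sum, permOp_conjTranspose]
  congr 1
  · simp
  · refine Fintype.sum_equiv (Equiv.inv _) _ _ fun τ => ?_
    rw [Equiv.inv_apply, inv_inv, map_inv]
    -- Unitarity: the inverse of φ(τ) is its conjugate transpose.
    change star (star ((φ m μ τ).1 i j)) • _ = _
    rw [star_star]

theorem permAlgHom_mul_of_comm {m : ℕ} {μ : YoungDiagram}
    {T : Matrix (Fin m → Fin d) (YoungIndex μ) ℂ} (hT : T ∈ intertwiners φ m d μ)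
    (x : MonoidAlgebra ℂ (Perm (Fin m))) :
    permAlgHom m d x * T = T * matrixAlgHom (φ m μ) x := by
  induction x using MonoidAlgebra.induction_on with
  | of σ => simpa [permAlgHom_single, matrixAlgHom_single] using hT σ
  | add x y hx hy => rw [map_add, map_add, Matrix.add_mul, Matrix.mul_add, hx, hy]
  | smul c x hx => rw [map_smul, map_smul, Matrix.smul_mul, Matrix.mul_smul, hx]

namespace IsPRIR

variable (hφ : IsPRIR N φ) {m : ℕ} (hm : m ≤ N) {μ ν : YoungDiagram} (hμ : μ.card = m)
  (hν : ν.card = m)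

include hφ hm hμ

theorem tensorUnit_mul (i j k l : YoungIndex μ) :
    tensorUnit φ m d μ i j * tensorUnit φ m d μ k l =
      if j = k then tensorUnit φ m d μ i l else 0 := by
  rw [tensorUnit, tensorUnit, ← map_mul, matrixUnit_mul_matrixUnit (hφ.isIrreducible hm hμ)]
  split_ifs
  · rfl
  · exact map_zero _

theorem trace_tensorUnit_of_ne {i j : YoungIndex μ} (hij : i ≠ j) :
    (tensorUnit φ m d μ i j).trace = 0 := by
  have h : tensorUnit φ m d μ i j = tensorUnit φ m d μ i i * tensorUnit φ m d μ i j := by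
    rw [hφ.tensorUnit_mul hm hμ, if_pos rfl]
  rw [h, Matrix.trace_mul_comm, hφ.tensorUnit_mul hm hμ, if_neg hij.symm, Matrix.trace_zero]

/-- The scalar is the entry (a, b) of φ^μ at an element of the group algebra that acts as `Y`. -/
theorem exists_tensorUnit_sandwich {Y : TensorOp m d} (hY : Y ∈ (permAlgHom m d).range)
    (a b : YoungIndex μ) : ∃ c : ℂ, tensorUnit φ m d μ a a * Y * tensorUnit φ m d μ b b =
      c • tensorUnit φ m d μ a b := by
  obtain ⟨y, rfl⟩ := hY
  refine ⟨matrixAlgHom (φ m μ) y a b, ?_⟩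
  change permAlgHom m d _ * permAlgHom m d y * permAlgHom m d _ = _ • permAlgHom m d _
  rw [← map_mul, ← map_mul, matrixUnit_mul, Finset.sum_mul, ← map_smul]
  congr 1
  simp only [smul_mul_assoc, matrixUnit_mul_matrixUnit (hφ.isIrreducible hm hμ), smul_ite,
    smul_zero, Finset.sum_ite_eq', Finset.mem_univ, if_true]

include hν in
theorem tensorUnit_mul_of_ne (hne : μ ≠ ν) (i j : YoungIndex μ) (k l : YoungIndex ν) :
    tensorUnit φ m d μ i j * tensorUnit φ m d ν k l = 0 := by
  rw [tensorUnit, tensorUnit, ← map_mul, matrixUnit_mul_matrixUnit_of_isEmpty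
    (hφ.isIrreducible hm hμ) (hφ.isIrreducible hm hν) (hφ.isEmpty_equiv hm hμ hν hne), map_zero]

include hν in
theorem tensorUnit_sandwich_of_ne (hne : μ ≠ ν) {Y : TensorOp m d}
    (hY : Y ∈ (permAlgHom m d).range) (a : YoungIndex μ) (b : YoungIndex ν) :
    tensorUnit φ m d μ a a * Y * tensorUnit φ m d ν b b = 0 := by
  obtain ⟨y, rfl⟩ := hY
  change permAlgHom m d _ * permAlgHom m d y * permAlgHom m d _ = _
  rw [← map_mul, ← map_mul, matrixUnit_mul, Finset.sum_mul]
  simp only [smul_mul_assoc, matrixUnit_mul_matrixUnit_of_isEmpty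
    (hφ.isIrreducible hm hμ) (hφ.isIrreducible hm hν) (hφ.isEmpty_equiv hm hμ hν hne), smul_zero,
    Finset.sum_const_zero, map_zero]

/-- Every tensor of the range of the operator of a diagonal matrix unit is the image of the basis
vector under a unique intertwiner. -/
noncomputable def intertwinersEquiv (d : ℕ) (i : YoungIndex μ) :
    intertwiners φ m d μ ≃ₗ[ℂ] LinearMap.range (Matrix.toLin' (tensorUnit φ m d μ i i)) where
  toFun T := ⟨T.1.mulVec (Pi.single i 1), T.1.mulVec (Pi.single i 1), by
    rw [Matrix.toLin'_apply, Matrix.mulVec_mulVec, tensorUnit, permAlgHom_mul_of_comm T.2,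
      matrixAlgHom_matrixUnit (hφ.isIrreducible hm hμ), ← Matrix.mulVec_mulVec,
      Matrix.single_one_mulVec_single_one]⟩
  map_add' S T := by
    exact Subtype.ext (Matrix.add_mulVec _ _ _)
  map_smul' c T := by
    exact Subtype.ext (Matrix.smul_mulVec _ _ _)
  invFun v := ⟨Matrix.of fun x j => (tensorUnit φ m d μ j i).mulVec v.1 x, by
    intro σ
    ext x j
    have h : permOp m d σ * tensorUnit φ m d μ j i =
        ∑ k, (φ m μ σ).1 k j • tensorUnit φ m d μ k i := by
      rw [tensorUnit, ← permAlgHom_single, ← map_mul, single_mul_matrixUnit, map_sum]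
      simp only [map_smul]
      rfl
    have h1 := congrFun (congrArg (fun A => Matrix.mulVec A v.1) h) x
    simp only [← Matrix.mulVec_mulVec, Matrix.sum_mulVec, Finset.sum_apply, Matrix.smul_mulVec,
      Pi.smul_apply, smul_eq_mul] at h1
    rw [Matrix.mul_apply, Matrix.mul_apply]
    simp only [Matrix.of_apply, mul_comm _ ((φ m μ σ).1 _ _)]
    exact h1⟩
  left_inv T := by
    apply Subtype.ext
    ext x j
    change (tensorUnit φ m d μ j i).mulVec (T.1.mulVec (Pi.single i 1)) x = T.1 x j
    rw [Matrix.mulVec_mulVec, tensorUnit, permAlgHom_mul_of_comm T.2,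
      matrixAlgHom_matrixUnit (hφ.isIrreducible hm hμ), ← Matrix.mulVec_mulVec,
      Matrix.single_one_mulVec_single_one, Matrix.mulVec_single_one]
    rfl
  right_inv := by
    rintro ⟨v, w, rfl⟩
    apply Subtype.ext
    ext x
    have h : (tensorUnit φ m d μ i i).mulVec ((tensorUnit φ m d μ i i).mulVec w) =
        (tensorUnit φ m d μ i i).mulVec w := by
      rw [Matrix.mulVec_mulVec, hφ.tensorUnit_mul hm hμ, if_pos rfl]
    simpa using congrFun h x

/-- The trace of an idempotent is its rank, and its range is identified with the space of
intertwiners. -/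
theorem trace_tensorUnit_self (i : YoungIndex μ) :
    (tensorUnit φ m d μ i i).trace = irrepMultiplicity φ m d μ := by
  have hidem : IsIdempotentElem (Matrix.toLin' (tensorUnit φ m d μ i i)) := by
    change Matrix.toLin' _ ∘ₗ Matrix.toLin' _ = _
    rw [← Matrix.toLin'_mul, hφ.tensorUnit_mul hm hμ, if_pos rfl]
  rw [irrepMultiplicity, (hφ.intertwinersEquiv hm hμ d i).finrank_eq, ← Matrix.trace_toLin'_eq]
  exact (LinearMap.isProj_range_iff_isIdempotentElem _).2 hidem |>.trace

open scoped ComplexOrder in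
-- A diagonal unit E equals E* E, so it vanishes as soon as its trace does; the other units have it
-- as a left factor.
theorem tensorUnit_eq_zero_of_multiplicity (h : irrepMultiplicity φ m d μ = 0)
    (i j : YoungIndex μ) : tensorUnit φ m d μ i j = 0 := by
  have h1 : tensorUnit φ m d μ i i = 0 := by
    rw [← Matrix.trace_conjTranspose_mul_self_eq_zero_iff, tensorUnit_conjTranspose,
      hφ.tensorUnit_mul hm hμ, if_pos rfl, hφ.trace_tensorUnit_self hm hμ, h, Nat.cast_zero]
  have h2 : tensorUnit φ m d μ i j = tensorUnit φ m d μ i i * tensorUnit φ m d μ i j := by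
    rw [hφ.tensorUnit_mul hm hμ, if_pos rfl]
  rw [h2, h1, zero_mul]

end IsPRIR

/-- The first column has more than `d` boxes, so two of its entries carry the same basis vector.
Exchanging them fixes the product vector but changes the sign of the antisymmetrizer. -/
theorem permAlgHom_colAntisymmetrizer {m : ℕ} {μ : YoungDiagram} (h : d < μ.colLen 0)
    (t : Fin m ≃ μ.cells) : permAlgHom m d (colAntisymmetrizer t) = 0 := by
  ext x y
  have hmem : ∀ a : Fin (μ.colLen 0), ((a : ℕ), 0) ∈ μ.cells :=
    fun a => YoungDiagram.mem_iff_lt_colLen.2 a.2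
  obtain ⟨a, b, hab, hy⟩ := Fintype.exists_ne_map_eq_of_card_lt
    (fun a : Fin (μ.colLen 0) => y (t.symm ⟨_, hmem a⟩)) (by simpa using h)
  set p := t.symm ⟨_, hmem a⟩ with hp
  set q := t.symm ⟨_, hmem b⟩ with hq
  have hpq : p ≠ q := by
    intro h1
    have h2 := t.symm.injective h1
    simp only [Subtype.mk.injEq, Prod.mk.injEq, and_true] at h2
    exact hab (Fin.ext h2)
  have hcol : colAntisymmetrizer t * MonoidAlgebra.single (swap p q) 1 = -colAntisymmetrizer t := by
    rw [colAntisymmetrizer_mul_single, Perm.sign_swap hpq]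
    · simp
    intro i
    rcases eq_or_ne i p with rfl | h1
    · rw [swap_apply_left, hp, hq]
      simp
    rcases eq_or_ne i q with rfl | h2
    · rw [swap_apply_right, hp, hq]
      simp
    rw [swap_apply_of_ne_of_ne h1 h2]
  have h1 := congrArg (fun z => permAlgHom m d z x y) hcol
  simp only [map_mul, permAlgHom_single, map_neg, Matrix.neg_apply, mul_permOp_apply] at h1
  have h2 : (fun i => y ((swap p q)⁻¹ i)) = y := by
    ext1 i
    rw [swap_inv]
    rcases eq_or_ne i p with rfl | h3
    · rw [swap_apply_left]
      exact hy.symm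
    rcases eq_or_ne i q with rfl | h4
    · rw [swap_apply_right]
      exact hy
    rw [swap_apply_of_ne_of_ne h3 h4]
  rw [h2] at h1
  exact self_eq_neg.1 h1

/-- A nonzero entry (p, q) of the column antisymmetrizer in φ^μ exhibits E_{ij} as a multiple of
E_{ip} b E_{qj}, where b is that antisymmetrizer and acts as zero on tensors. -/
theorem IsPRIR.tensorUnit_eq_zero_of_lt_colLen (hφ : IsPRIR N φ) {m : ℕ} (hm : m ≤ N)
    {μ : YoungDiagram} (hμ : μ.card = m) (h : d < μ.colLen 0) (i j : YoungIndex μ) :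
    tensorUnit φ m d μ i j = 0 := by
  obtain ⟨t, p, q, hpq⟩ := (hφ.irrep m μ hm hμ).exists_matrixAlgHom_ne_zero
  have h1 : matrixUnit (φ m μ) i p * colAntisymmetrizer t * matrixUnit (φ m μ) q j =
      matrixAlgHom (φ m μ) (colAntisymmetrizer t) p q • matrixUnit (φ m μ) i j := by
    rw [matrixUnit_mul, Finset.sum_mul]
    simp only [smul_mul_assoc, matrixUnit_mul_matrixUnit (hφ.isIrreducible hm hμ), smul_ite,
      smul_zero, Finset.sum_ite_eq', Finset.mem_univ, if_true]
  have h2 := congrArg (permAlgHom m d) h1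
  rw [map_mul, map_mul, permAlgHom_colAntisymmetrizer h, mul_zero, zero_mul, map_smul] at h2
  exact (smul_eq_zero.1 h2.symm).resolve_left hpq

namespace IsPRIR

variable (hφ : IsPRIR N φ) {M k : ℕ} (hN : M + k ≤ N) {α β μ : YoungDiagram} (hα : α.card = M)
  (hβ : β.card = M) (hμ : μ.card = M + k)

include hφ hN hα hμ

/-- In PRIR form S(M) acts only on the initial part of a path, here `a`, and leaves the continuation
`r` alone. -/
theorem tensorUnit_mul_extendOp_permAlgHom (r : YoungPath α μ) (i : YoungIndex μ)
    (a : YoungIndex α) (x : MonoidAlgebra ℂ (Perm (Fin M))) :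
    tensorUnit φ (M + k) d μ i (a.comp r) * extendOp M k d (permAlgHom M d x) =
      ∑ c, matrixAlgHom (φ M α) x a c • tensorUnit φ (M + k) d μ i (c.comp r) := by
  induction x using MonoidAlgebra.induction_on with
  | of σ =>
    rw [MonoidAlgebra.of_apply, permAlgHom_single, matrixAlgHom_single, extendOp_permOp, tensorUnit,
      ← permAlgHom_single, ← map_mul, matrixUnit_mul_single, map_sum]
    simp only [map_smul]
    symm
    refine Finset.sum_of_injOn (fun c : YoungIndex α => c.comp r)
      (YoungPath.comp_injective_left r).injOn (by simp) ?_ ?_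
    · intro q _ hq
      rw [hφ.restrict_comp_ne hα σ a k r q (fun c hc => hq ⟨c, by simp, hc⟩) hN hμ, zero_smul]
    · intro c _
      rw [hφ.restrict_comp hα σ a c k r hN hμ]
      rfl
  | add x y hx hy =>
    simp only [map_add, mul_add, hx, hy, Matrix.add_apply, add_smul, Finset.sum_add_distrib]
  | smul c x hx =>
    simp only [map_smul, mul_smul_comm, hx, Matrix.smul_apply, Finset.smul_sum, smul_smul,
      smul_eq_mul]

theorem tensorUnit_mul_extendOp (r : YoungPath α μ) (i : YoungIndex μ) (a b : YoungIndex α) :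
    tensorUnit φ (M + k) d μ i (a.comp r) * extendOp M k d (tensorUnit φ M d α a b) =
      tensorUnit φ (M + k) d μ i (b.comp r) := by
  rw [tensorUnit.eq_1 φ M, hφ.tensorUnit_mul_extendOp_permAlgHom hN hα hμ, Finset.sum_eq_single b]
  · rw [matrixAlgHom_matrixUnit (hφ.isIrreducible (by omega) hα), Matrix.single_apply_same, one_smul]
  · intro c _ hc
    rw [matrixAlgHom_matrixUnit (hφ.isIrreducible (by omega) hα), Matrix.single_apply_of_ne,
      zero_smul]
    exact fun h => hc h.2.symm
  · simp

theorem extendOp_mul_tensorUnit (r : YoungPath α μ) (i : YoungIndex μ) (a b : YoungIndex α) :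
    extendOp M k d (tensorUnit φ M d α b a) * tensorUnit φ (M + k) d μ (a.comp r) i =
      tensorUnit φ (M + k) d μ (b.comp r) i := by
  have h := congrArg Matrix.conjTranspose
    (hφ.tensorUnit_mul_extendOp (d := d) hN hα hμ r i a b)
  rwa [Matrix.conjTranspose_mul, ← extendOp_conjTranspose, tensorUnit_conjTranspose,
    tensorUnit_conjTranspose, tensorUnit_conjTranspose] at h

include hβ in
-- The unit absorbs E^α_{aa} on the left and E^β_{bb} on the right, and both can be pulled out of
-- the partial trace.
theorem partialTrace_tensorUnit_eq (r : YoungPath α μ) (s : YoungPath β μ) (a : YoungIndex α)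
    (b : YoungIndex β) :
    partialTrace M k d (tensorUnit φ (M + k) d μ (a.comp r) (b.comp s)) =
      tensorUnit φ M d α a a *
        partialTrace M k d (tensorUnit φ (M + k) d μ (a.comp r) (b.comp s)) *
        tensorUnit φ M d β b b := by
  rw [← partialTrace_extendOp_mul, ← partialTrace_mul_extendOp,
    hφ.extendOp_mul_tensorUnit hN hα hμ, hφ.tensorUnit_mul_extendOp hN hβ hμ]

include hβ in
theorem partialTrace_tensorUnit_of_ne (hne : α ≠ β) (r : YoungPath α μ) (s : YoungPath β μ)
    (a : YoungIndex α) (b : YoungIndex β) :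
    partialTrace M k d (tensorUnit φ (M + k) d μ (a.comp r) (b.comp s)) = 0 := by
  rw [hφ.partialTrace_tensorUnit_eq hN hα hβ hμ]
  exact hφ.tensorUnit_sandwich_of_ne (by omega) hα hβ hne
    (partialTrace_mem_range (tensorUnit_mem_range _ _ _ _)) a b

theorem exists_partialTrace_tensorUnit (r s : YoungPath α μ) (a : YoungIndex α) : ∃ c : ℂ,
    partialTrace M k d (tensorUnit φ (M + k) d μ (a.comp r) (a.comp s)) =
      c • tensorUnit φ M d α a a ∧
    (tensorUnit φ (M + k) d μ (a.comp r) (a.comp s)).trace = c * irrepMultiplicity φ M d α := by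
  obtain ⟨c, hc⟩ := hφ.exists_tensorUnit_sandwich (by omega) hα (partialTrace_mem_range
    (tensorUnit_mem_range (φ := φ) (d := d) (M + k) μ (a.comp r) (a.comp s))) a a
  rw [← hφ.partialTrace_tensorUnit_eq hN hα hα hμ] at hc
  refine ⟨c, hc, ?_⟩
  rw [← trace_partialTrace, hc, Matrix.trace_smul, hφ.trace_tensorUnit_self (by omega) hα,
    smul_eq_mul]

/-- Off-diagonal units are traceless, so c · m_α = 0: either the scalar vanishes, or E^α itself
does. -/
theorem partialTrace_tensorUnit_of_path_ne {r s : YoungPath α μ} (hrs : r ≠ s)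
    (a : YoungIndex α) :
    partialTrace M k d (tensorUnit φ (M + k) d μ (a.comp r) (a.comp s)) = 0 := by
  obtain ⟨c, hc, htr⟩ := hφ.exists_partialTrace_tensorUnit (d := d) hN hα hμ r s a
  rw [hφ.trace_tensorUnit_of_ne hN hμ ((YoungPath.comp_right_injective a).ne hrs), zero_eq_mul] at htr
  rw [hc]
  rcases htr with h | h
  · rw [h, zero_smul]
  · rw [hφ.tensorUnit_eq_zero_of_multiplicity (by omega) hα (by exact_mod_cast h), smul_zero]

/-- Comparing traces gives m_μ = c · m_α, which explains the normalization of the operators F; the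
form without division also covers m_α = 0. -/
theorem smul_partialTrace_tensorUnit (r : YoungPath α μ) (a : YoungIndex α) :
    (irrepMultiplicity φ M d α : ℂ) •
      partialTrace M k d (tensorUnit φ (M + k) d μ (a.comp r) (a.comp r)) =
      (irrepMultiplicity φ (M + k) d μ : ℂ) • tensorUnit φ M d α a a := by
  obtain ⟨c, hc, htr⟩ := hφ.exists_partialTrace_tensorUnit (d := d) hN hα hμ r r a
  rw [hφ.trace_tensorUnit_self hN hμ] at htr
  rw [hc, htr, smul_smul, mul_comm]

end IsPRIR

end TensorUnit

/-! ### The operators F_μ(α) as sums of orthogonal projectors. -/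

section Projectors

open YoungDiagram

variable {φ : MatrixFamily} {one : (α : YoungDiagram) → YoungIndex α} {M k d : ℕ}

/-- The isometry, up to a scalar factor, from the image of `E^α_{1 1}` onto the range of the
projector `F_{i i}^{r r}`. -/
noncomputable def projFactor (φ : MatrixFamily) (one : (α : YoungDiagram) → YoungIndex α)
    (M k d : ℕ) {α μ : YoungDiagram} (r : YoungPath α μ) (i : YoungIndex μ) :
    Matrix (Fin (M + k + k) → Fin d) (Fin M → Fin d) ℂ :=
  extendOp (M + k) k d (tensorUnit φ (M + k) d μ i ((one α).comp r)) * pairInsertion M k d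

theorem opF_self_eq {α μ : YoungDiagram} (r : YoungPath α μ) (i : YoungIndex μ) :
    opF φ one (M + k) k d r r i i =
      ((irrepMultiplicity φ M d α : ℂ) / irrepMultiplicity φ (M + k) d μ) •
        (projFactor φ one M k d r i * (projFactor φ one M k d r i).conjTranspose) := by
  rw [opF, Real.sqrt_mul_self (Nat.cast_nonneg _), Nat.add_sub_cancel, contractionOp_eq,
    opE_eq_extendOp, opE_eq_extendOp, projFactor, Matrix.conjTranspose_mul,
    ← extendOp_conjTranspose, tensorUnit_conjTranspose]
  push_cast
  simp only [Matrix.mul_assoc]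

variable (hφ : IsPRIR (M + k) φ) {α β μ ν : YoungDiagram}
  (hα : α.card = M) (hβ : β.card = M) (hμ : μ.card = M + k) (hν : ν.card = M + k)

/-- All Gram operators reduce to partial traces of products of matrix units. -/
theorem projFactor_conjTranspose_mul (r : YoungPath α μ) (s : YoungPath β ν) (i : YoungIndex μ)
    (j : YoungIndex ν) :
    (projFactor φ one M k d r i).conjTranspose * projFactor φ one M k d s j =
      partialTrace M k d (tensorUnit φ (M + k) d μ ((one α).comp r) i *
        tensorUnit φ (M + k) d ν j ((one β).comp s)) := by
  rw [← pairInsertion_conjTranspose_mul_extendOp_mul, map_mul, projFactor, projFactor,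
    Matrix.conjTranspose_mul, ← extendOp_conjTranspose, tensorUnit_conjTranspose]
  simp only [Matrix.mul_assoc]

include hφ hα hβ hμ hν in
theorem projFactor_conjTranspose_mul_of_ne (hne : (α, μ) ≠ (β, ν)) (r : YoungPath α μ)
    (s : YoungPath β ν) (i : YoungIndex μ) (j : YoungIndex ν) :
    (projFactor φ one M k d r i).conjTranspose * projFactor φ one M k d s j = 0 := by
  rw [projFactor_conjTranspose_mul]
  by_cases h : μ = ν
  · subst h
    have hαβ : α ≠ β := by
      rintro rfl
      exact hne rfl
    rw [hφ.tensorUnit_mul le_rfl hμ]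
    split_ifs
    · exact hφ.partialTrace_tensorUnit_of_ne le_rfl hα hβ hμ hαβ r s _ _
    · exact map_zero _
  · rw [hφ.tensorUnit_mul_of_ne le_rfl hμ hν h, map_zero]

include hφ hα hμ

theorem projFactor_conjTranspose_mul_of_index_ne {r s : YoungPath α μ} {i j : YoungIndex μ}
    (hne : (r, i) ≠ (s, j)) :
    (projFactor φ one M k d r i).conjTranspose * projFactor φ one M k d s j = 0 := by
  rw [projFactor_conjTranspose_mul, hφ.tensorUnit_mul le_rfl hμ]
  split_ifs with h
  · subst h
    exact hφ.partialTrace_tensorUnit_of_path_ne le_rfl hα hμ (fun h => hne (by rw [h])) _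
  · exact map_zero _

/-- For A = `projFactor`, the relation m_α A* A = m_μ E^α_{11} combines with A E^α_{11} = A,
obtained by moving E^α_{11} through the pair insertion into E^μ. -/
theorem smul_projFactor_mul_conjTranspose_mul_self (r : YoungPath α μ) (i : YoungIndex μ) :
    ((irrepMultiplicity φ M d α : ℂ) / irrepMultiplicity φ (M + k) d μ) •
      (projFactor φ one M k d r i * (projFactor φ one M k d r i).conjTranspose *
        projFactor φ one M k d r i) = projFactor φ one M k d r i := by
  -- For m_μ = 0 the quotient is 0 by convention, but then the factor vanishes too.
  rcases eq_or_ne (irrepMultiplicity φ (M + k) d μ) 0 with h0 | h0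
  · have h1 : projFactor φ one M k d r i = 0 := by
      rw [projFactor, hφ.tensorUnit_eq_zero_of_multiplicity le_rfl hμ h0, map_zero, Matrix.zero_mul]
    rw [h1, Matrix.mul_zero, smul_zero]
  · have h1 : (irrepMultiplicity φ (M + k) d μ : ℂ) ≠ 0 := Nat.cast_ne_zero.2 h0
    rw [Matrix.mul_assoc, projFactor_conjTranspose_mul, hφ.tensorUnit_mul le_rfl hμ, if_pos rfl,
      div_eq_inv_mul, mul_smul, ← Matrix.mul_smul _ (irrepMultiplicity φ M d α : ℂ),
      hφ.smul_partialTrace_tensorUnit le_rfl hα hμ, Matrix.mul_smul, smul_smul, inv_mul_cancel₀ h1,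
      one_smul, projFactor, Matrix.mul_assoc, ← extendOp_extendOp_mul_pairInsertion,
      ← Matrix.mul_assoc, ← map_mul, hφ.tensorUnit_mul_extendOp le_rfl hα hμ]

theorem projF_mul_projFactor (r : YoungPath α μ) (i : YoungIndex μ) :
    projF φ one (M + k) k d α μ * projFactor φ one M k d r i = projFactor φ one M k d r i := by
  simp only [projF, opF_self_eq, Matrix.sum_mul, Matrix.smul_mul]
  rw [Finset.sum_eq_single r, Finset.sum_eq_single i]
  · exact smul_projFactor_mul_conjTranspose_mul_self hφ hα hμ r i
  · intro j _ hj
    rw [Matrix.mul_assoc, projFactor_conjTranspose_mul_of_index_ne hφ hα hμ, Matrix.mul_zero,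
      smul_zero]
    exact fun h => hj (Prod.mk.inj h).2
  · simp
  · intro s _ hs
    refine Finset.sum_eq_zero fun j _ => ?_
    rw [Matrix.mul_assoc, projFactor_conjTranspose_mul_of_index_ne hφ hα hμ, Matrix.mul_zero,
      smul_zero]
    exact fun h => hs (Prod.mk.inj h).1
  · simp

include hβ hν in
theorem projF_mul_projFactor_of_ne (hne : (α, μ) ≠ (β, ν)) (s : YoungPath β ν)
    (j : YoungIndex ν) :
    projF φ one (M + k) k d α μ * projFactor φ one M k d s j = 0 := by
  simp only [projF, opF_self_eq, Matrix.sum_mul, Matrix.smul_mul, Matrix.mul_assoc,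
    projFactor_conjTranspose_mul_of_ne hφ hα hβ hμ hν hne, Matrix.mul_zero, smul_zero,
    Finset.sum_const_zero]

include hβ hν in
theorem projF_mul_projF_of_ne (hne : (α, μ) ≠ (β, ν)) :
    projF φ one (M + k) k d α μ * projF φ one (M + k) k d β ν = 0 := by
  rw [projF.eq_1 φ one (M + k) k d β ν]
  simp only [opF_self_eq, Matrix.mul_sum, Matrix.mul_smul, ← Matrix.mul_assoc,
    projF_mul_projFactor_of_ne hφ hα hβ hμ hν hne, Matrix.zero_mul, smul_zero,
    Finset.sum_const_zero]

omit hφ hα hμ in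
theorem projF_conjTranspose (α μ : YoungDiagram) :
    (projF φ one (M + k) k d α μ).conjTranspose = projF φ one (M + k) k d α μ := by
  simp only [projF, opF_self_eq, Matrix.conjTranspose_sum, Matrix.conjTranspose_smul,
    Matrix.conjTranspose_mul, Matrix.conjTranspose_conjTranspose]
  simp

theorem isStarProjection_projF : IsStarProjection (projF φ one (M + k) k d α μ) := by
  refine ⟨?_, projF_conjTranspose α μ⟩
  change projF φ one (M + k) k d α μ * projF φ one (M + k) k d α μ = projF φ one (M + k) k d α μ
  conv_lhs => arg 2; rw [projF]
  simp only [opF_self_eq, Matrix.mul_sum, Matrix.mul_smul, ← Matrix.mul_assoc,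
    projF_mul_projFactor hφ hα hμ]
  simp only [projF, opF_self_eq]

end Projectors

/-! ### The sum of the projectors is the identity of the ideal. -/

section Ideal

open YoungDiagram

variable {φ : MatrixFamily} {one : (α : YoungDiagram) → YoungIndex α} {M k d : ℕ}

theorem mem_youngDiagramsAbove {α μ : YoungDiagram} {m d : ℕ} :
    μ ∈ youngDiagramsAbove α m d ↔ (μ.card = m ∧ μ.colLen 0 ≤ d) ∧ α ≤ μ := by
  simp only [youngDiagramsAbove, Finset.mem_filter, mem_youngDiagrams]

theorem sumProjF_mul_projFactor (hφ : IsPRIR (M + k) φ) {α μ : YoungDiagram} (hα : α.card = M)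
    (hμ : μ.card = M + k) (hd : μ.colLen 0 ≤ d) (r : YoungPath α μ) (i : YoungIndex μ) :
    sumProjF φ one (M + k) k d * projFactor φ one M k d r i = projFactor φ one M k d r i := by
  -- A subdiagram of `μ` has no more rows than `μ`, so the pair (α, μ) does occur in the sum.
  have hαd : α.colLen 0 ≤ d := by
    refine le_trans ?_ hd
    by_contra! hlt
    have h1 := r.le (mem_iff_lt_colLen.2 hlt)
    exact lt_irrefl _ (mem_iff_lt_colLen.1 h1)
  rw [sumProjF, Nat.add_sub_cancel, Matrix.sum_mul,
    Finset.sum_eq_single_of_mem α (mem_youngDiagrams.2 ⟨hα, hαd⟩), Matrix.sum_mul,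
    Finset.sum_eq_single_of_mem μ (mem_youngDiagramsAbove.2 ⟨⟨hμ, hd⟩, r.le⟩)]
  · exact projF_mul_projFactor hφ hα hμ r i
  · intro ν hν hne
    exact projF_mul_projFactor_of_ne hφ hα hα (mem_youngDiagramsAbove.1 hν).1.1 hμ
      (fun h => hne (Prod.mk.inj h).2) r i
  · intro β hβ hne
    rw [Matrix.sum_mul]
    refine Finset.sum_eq_zero fun ν hν => ?_
    exact projF_mul_projFactor_of_ne hφ (mem_youngDiagrams.1 hβ).1 hα
      (mem_youngDiagramsAbove.1 hν).1.1 hμ (fun h => hne (Prod.mk.inj h).1) r i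

/-- It suffices to treat matrix units of diagrams with at most `d` rows. Cutting the column index at
level M, one factors off E^α_{1a} and slides it through the pair insertion, which leaves a
`projFactor` on the left. -/
theorem sumProjF_mul_extendOp_mul_pairInsertion (hφ : IsPRIR (M + k) φ) {X : TensorOp (M + k) d}
    (hX : X ∈ (permAlgHom (M + k) d).range) :
    sumProjF φ one (M + k) k d * (extendOp (M + k) k d X * pairInsertion M k d) =
      extendOp (M + k) k d X * pairInsertion M k d := by
  obtain ⟨x, rfl⟩ := hX
  change sumProjF φ one (M + k) k d *
      (extendOp (M + k) k d (permAlgHom (M + k) d x) * pairInsertion M k d) =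
    extendOp (M + k) k d (permAlgHom (M + k) d x) * pairInsertion M k d
  have hx : x ∈ Submodule.span ℂ {x | ∃ μ ∈ youngDiagrams (M + k) (M + k), ∃ i j,
      x = matrixUnit (φ (M + k) μ) i j} := by
    rw [hφ.span_matrixUnit le_rfl]
    trivial
  induction hx using Submodule.span_induction with
  | mem x hx =>
    obtain ⟨μ, hμ, i, j, rfl⟩ := hx
    rw [mem_youngDiagrams_self] at hμ
    rw [← tensorUnit]
    rcases lt_or_ge d (μ.colLen 0) with hd | hd
    · rw [hφ.tensorUnit_eq_zero_of_lt_colLen le_rfl hμ hd, map_zero, Matrix.zero_mul,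
        Matrix.mul_zero]
    · obtain ⟨α, a, r, hα, rfl⟩ := j.exists_eq_comp (M := M) (Nat.zero_le _) (by omega)
      rw [← hφ.tensorUnit_mul_extendOp le_rfl hα hμ r i (one α) a, map_mul, Matrix.mul_assoc,
        extendOp_extendOp_mul_pairInsertion, ← Matrix.mul_assoc (extendOp _ _ _ _), ← projFactor,
        ← Matrix.mul_assoc, sumProjF_mul_projFactor hφ hα hμ hd]
  | zero => simp only [map_zero, Matrix.zero_mul, Matrix.mul_zero]
  | add x y _ _ hx hy => simp only [map_add, Matrix.add_mul, Matrix.mul_add, hx, hy]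
  | smul c x _ hx => simp only [map_smul, Matrix.smul_mul, Matrix.mul_smul, hx]

/-- In a V^(k) b = (a W) W* b the factor a W has the form (X ⊗ 1) W, which the sum fixes from the
left. -/
theorem sumProjF_mul_of_mem_maximalIdeal (hφ : IsPRIR (M + k) φ) {x : TensorOp (M + k + k) d}
    (hx : x ∈ maximalIdeal (M + k) k d) : sumProjF φ one (M + k) k d * x = x := by
  induction hx using Submodule.span_induction with
  | mem x hx =>
    obtain ⟨a, ha, b, -, rfl⟩ := hx
    obtain ⟨X, hX, h⟩ := exists_mul_extendOp_mul_pairInsertion ha 1 (Subalgebra.one_mem _)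
    rw [map_one, Matrix.one_mul] at h
    rw [contractionOp_eq, ← Matrix.mul_assoc a, h, Matrix.mul_assoc (_ * _), ← Matrix.mul_assoc,
      sumProjF_mul_extendOp_mul_pairInsertion hφ hX]
  | zero => exact mul_zero _
  | add x y _ _ hx hy => rw [mul_add, hx, hy]
  | smul c x _ hx => rw [mul_smul_comm, hx]

theorem contractionOp_conjTranspose :
    (contractionOp (M + k) k d).conjTranspose = contractionOp (M + k) k d := by
  rw [contractionOp_eq, Matrix.conjTranspose_mul, Matrix.conjTranspose_conjTranspose]

theorem conjTranspose_mem_maximalIdeal {x : TensorOp (M + k + k) d}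
    (hx : x ∈ maximalIdeal (M + k) k d) : x.conjTranspose ∈ maximalIdeal (M + k) k d := by
  induction hx using Submodule.span_induction with
  | mem x hx =>
    obtain ⟨a, ha, b, hb, rfl⟩ := hx
    refine Submodule.subset_span ⟨_, conjTranspose_mem_partiallyTransposedAlgebra hb, _,
      conjTranspose_mem_partiallyTransposedAlgebra ha, ?_⟩
    rw [Matrix.conjTranspose_mul, Matrix.conjTranspose_mul, contractionOp_conjTranspose,
      Matrix.mul_assoc]
  | zero => rw [Matrix.conjTranspose_zero]; exact Submodule.zero_mem _
  | add x y _ _ hx hy => rw [Matrix.conjTranspose_add]; exact Submodule.add_mem _ hx hy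
  | smul c x _ hx => rw [Matrix.conjTranspose_smul]; exact Submodule.smul_mem _ _ hx

theorem sumProjF_conjTranspose :
    (sumProjF φ one (M + k) k d).conjTranspose = sumProjF φ one (M + k) k d := by
  simp only [sumProjF, Matrix.conjTranspose_sum, projF_conjTranspose]

theorem sumProjF_mem_maximalIdeal (N : ℕ) : sumProjF φ one N k d ∈ maximalIdeal N k d := by
  refine Submodule.sum_mem _ fun α _ => Submodule.sum_mem _ fun μ _ => Submodule.sum_mem _ fun r _ =>
    Submodule.sum_mem _ fun i _ => Submodule.smul_mem _ _ (Submodule.subset_span ?_)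
  refine ⟨_, ?_, _, ?_, rfl⟩ <;> rw [opE_eq_extendOp] <;>
    exact extendOp_permOp_mem (tensorUnit_mem_range _ _ _ _)

end Ideal

theorem mainTheorem10 (N k d : ℕ) (hk : k ≤ N) (φ : MatrixFamily) (hφ : IsPRIR N φ)
    (one : (α : YoungDiagram) → YoungIndex α) :
    (∀ α ∈ youngDiagrams (N - k) d, ∀ μ ∈ youngDiagramsAbove α N d,
      IsStarProjection (projF φ one N k d α μ)) ∧
    (∀ α ∈ youngDiagrams (N - k) d, ∀ μ ∈ youngDiagramsAbove α N d,
      ∀ β ∈ youngDiagrams (N - k) d, ∀ ν ∈ youngDiagramsAbove β N d,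
        (α, μ) ≠ (β, ν) → projF φ one N k d α μ * projF φ one N k d β ν = 0) ∧
    sumProjF φ one N k d ∈ maximalIdeal N k d ∧
    ∀ x ∈ maximalIdeal N k d,
      sumProjF φ one N k d * x = x ∧ x * sumProjF φ one N k d = x := by
  obtain ⟨M, rfl⟩ := Nat.exists_eq_add_of_le' hk
  rw [Nat.add_sub_cancel]
  refine ⟨fun α hα μ hμ => ?_, fun α hα μ hμ β hβ ν hν hne => ?_, sumProjF_mem_maximalIdeal _,
    fun x hx => ⟨sumProjF_mul_of_mem_maximalIdeal hφ hx, ?_⟩⟩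
  · exact isStarProjection_projF hφ (YoungDiagram.mem_youngDiagrams.1 hα).1
      (mem_youngDiagramsAbove.1 hμ).1.1
  · exact projF_mul_projF_of_ne hφ (YoungDiagram.mem_youngDiagrams.1 hα).1
      (YoungDiagram.mem_youngDiagrams.1 hβ).1 (mem_youngDiagramsAbove.1 hμ).1.1
      (mem_youngDiagramsAbove.1 hν).1.1 hne
  -- The ideal and the sum are stable under adjoints, so the left identity applied to x* gives the
  -- right identity for `x`.
  · have h := congrArg Matrix.conjTranspose (sumProjF_mul_of_mem_maximalIdeal (one := one) hφ
      (conjTranspose_mem_maximalIdeal hx))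
    rwa [Matrix.conjTranspose_mul, Matrix.conjTranspose_conjTranspose, sumProjF_conjTranspose] at h
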